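/- Let $\mathbb H$ be the quaternions $q=x_0+x_1\mathbf i+x_2\mathbf j+x_3\mathbf k$ and put $$D=\tfrac12\Big(\frac{\partial}{\partial x_0}+\mathbf i\frac{\partial}{\partial x_1}+\mathbf j\frac{\partial}{\partial x_2}+\mathbf k\frac{\partial}{\partial x_3}\Big),\qquad \bar D=\tfrac12\Big(\frac{\partial}{\partial x_0}-\mathbf i\frac{\partial}{\partial x_1}-\mathbf j\frac{\partial}{\partial x_2}-\mathbf k\frac{\partial}{\partial x_3}\Big),$$ the units acting by multiplication from the left, and $$d\sigma=dx_1\wedge dx_2\wedge dx_3-\mathbf i\,dx_0\wedge dx_2\wedge dx_3+\mathbf j\,dx_0\wedge dx_1\wedge dx_3-\mathbf k\,dx_0\wedge dx_1\wedge dx_2 .$$ **Theorem.** Let $\Omega\subset\mathbb H$ be a bounded Lipschitz domain, that is, a bounded, connected, nonempty open set whose boundary is locally, in suitable rotated Cartesian coordinates, the graph of a Lipschitz function, with $\Omega$ locally on exactly one side of the graph. Let $F:\overline\Omega\to\mathbb H$ belong to $C^1(\overline\Omega)$ (it is $C^1$ in $\Omega$, and $F$ and its first partial derivatives extend continuously to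 $\overline\Omega$), and suppose that $F$ is left-regular in $\Omega$, i.e. $DF=0$ in $\Omega$. Then $|\bar DF|^2$ is integrable over $\Omega$, the $3$-form $\bar F\,d\sigma\,\bar DF$ is integrable over $\partial\Omega$, and $$\int_{\Omega}|\bar DF|^2\,dV=\frac12\int_{\partial\Omega}\bar F\,d\sigma\,\bar DF .$$ Here $dV=dx_0\wedge dx_1\wedge dx_2\wedge dx_3$ is the volume element, $\bar F$ is the quaternionic conjugate of $F$, $\partial\Omega$ carries the boundary orientation (outward normal first), $\bar DF$ on $\partial\Omega$ is the continuous extension of $\bar DF$ from $\Omega$, and the equality is one of quaternions, so that the right-hand side is real. -/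

import Mathlib

open Set Filter Topology MeasureTheory
open scoped Quaternion ContDiff NNReal

namespace QuatStokes

noncomputable section

/-- The Borel σ-algebra on `ℍ`. With it `volume` is the Lebesgue measure
`dV = dx₀ ∧ dx₁ ∧ dx₂ ∧ dx₃`, normalised to be one on the unit cube. -/
instance : MeasurableSpace ℍ := borel ℍ

instance : BorelSpace ℍ := ⟨rfl⟩

/-- The real basis `1, i, j, k` of `ℍ`. -/
def qunit : Fin 4 → ℍ := ![⟨1, 0, 0, 0⟩, ⟨0, 1, 0, 0⟩, ⟨0, 0, 1, 0⟩, ⟨0, 0, 0, 1⟩]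

/-- The partial derivative `∂F/∂x_k`. -/
def partialDeriv (k : Fin 4) (F : ℍ → ℍ) (q : ℍ) : ℍ := fderiv ℝ F q (qunit k)

/-- The (left) Cauchy–Riemann–Fueter operator `D = ½ (∂₀ + i ∂₁ + j ∂₂ + k ∂₃)`,
the units multiplying from the left. -/
def fueterD (F : ℍ → ℍ) (q : ℍ) : ℍ :=
  (1 / 2 : ℝ) • ∑ k : Fin 4, qunit k * partialDeriv k F q

/-- The conjugate operator `D̄ = ½ (∂₀ - i ∂₁ - j ∂₂ - k ∂₃)`. -/
def fueterDbar (F : ℍ → ℍ) (q : ℍ) : ℍ :=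
  (1 / 2 : ℝ) • ∑ k : Fin 4, star (qunit k) * partialDeriv k F q

/-- `F` is left-regular in `Ω`: of class `C¹` there, with `D F = 0`. -/
def IsLeftRegular (Ω : Set ℍ) (F : ℍ → ℍ) : Prop :=
  ContDiffOn ℝ 1 F Ω ∧ ∀ q ∈ Ω, fueterD F q = 0

/-- `F ∈ C¹(Ω̄)` for an open set `Ω`: `F` is `C¹` in `Ω`, it is continuous on the closure, and its
first derivatives extend continuously from `Ω` to the closure. -/
def IsC1Closure (Ω : Set ℍ) (F : ℍ → ℍ) : Prop :=
  ContDiffOn ℝ 1 F Ω ∧ ContinuousOn F (closure Ω) ∧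
    ∃ G : ℍ → (ℍ →L[ℝ] ℍ), ContinuousOn G (closure Ω) ∧ EqOn G (fderiv ℝ F) Ω

/-! ### Differential 3-forms -/

/-- The coordinate 1-form `dx_k`, i.e. the `k`-th real coordinate. -/
def dx (k : Fin 4) : ℍ →ₗ[ℝ] ℝ := (QuaternionAlgebra.basisOneIJK (-1 : ℝ) 0 (-1)).coord k

/-- The real 3-form `dx_a ∧ dx_b ∧ dx_c`: `(v₀, v₁, v₂) ↦ det (dx_{(a,b,c)_s} (v_r))_{r,s}`. -/
def dxWedge (a b c : Fin 4) : ℍ [⋀^Fin 3]→ₗ[ℝ] ℝ :=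
  (Matrix.detRowAlternating (n := Fin 3) (R := ℝ)).compLinearMap
    (LinearMap.pi ![dx a, dx b, dx c])

/-- The quaternionic 3-form
`dσ = dx₁∧dx₂∧dx₃ - i dx₀∧dx₂∧dx₃ + j dx₀∧dx₁∧dx₃ - k dx₀∧dx₁∧dx₂`. -/
def dsigma : ℍ [⋀^Fin 3]→ₗ[ℝ] ℍ :=
  (LinearMap.toSpanSingleton ℝ ℍ (qunit 0)).compAlternatingMap (dxWedge 1 2 3)
    - (LinearMap.toSpanSingleton ℝ ℍ (qunit 1)).compAlternatingMap (dxWedge 0 2 3)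
    + (LinearMap.toSpanSingleton ℝ ℍ (qunit 2)).compAlternatingMap (dxWedge 0 1 3)
    - (LinearMap.toSpanSingleton ℝ ℍ (qunit 3)).compAlternatingMap (dxWedge 0 1 2)

/-- The `ℍ`-valued 3-covector `a dσ b`. -/
def sandwich (a b : ℍ) : ℍ [⋀^Fin 3]→ₗ[ℝ] ℍ :=
  (LinearMap.mulLeft ℝ a ∘ₗ LinearMap.mulRight ℝ b).compAlternatingMap dsigma

/-- The 3-form `F̄ dσ D̄F` on `Ω̄`. At boundary points `D̄F` stands for its continuous extension
from `Ω`. -/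
def stokesForm (Ω : Set ℍ) (F : ℍ → ℍ) (q : ℍ) : ℍ [⋀^Fin 3]→ₗ[ℝ] ℍ :=
  sandwich (star (F q)) (extendFrom Ω (fueterDbar F) q)

/-! ### Lipschitz domains and integration of 3-forms over their oriented boundary -/

/-- The quaternion `s + y₀ i + y₁ j + y₂ k`. -/
def point (s : ℝ) (y : Fin 3 → ℝ) : ℍ := ⟨s, y 0, y 1, y 2⟩

/-- A piece of Lipschitz boundary: after a rotation of `ℍ`, the set `Ω` agrees, inside the open set
`nbhd`, with the region `s < height y` on one side of a Lipschitz graph. -/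
structure BoundaryChart (Ω : Set ℍ) where
  rot : ℍ ≃ₗᵢ[ℝ] ℍ
  det_rot : LinearMap.det (rot.toLinearEquiv : ℍ →ₗ[ℝ] ℍ) = 1
  height : (Fin 3 → ℝ) → ℝ
  lipschitz_height : ∃ K : ℝ≥0, LipschitzWith K height
  nbhd : Set ℍ
  isOpen_nbhd : IsOpen nbhd
  mem_iff : ∀ (s : ℝ) (y : Fin 3 → ℝ), rot (point s y) ∈ nbhd →
    (rot (point s y) ∈ Ω ↔ s < height y)

/-- The parametrisation `y ↦ rot (height y, y)` of the boundary. Since `rot` preserves the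
orientation and `Ω` lies below the graph, it is positively oriented for the boundary orientation
(outward normal first). -/
def BoundaryChart.param {Ω : Set ℍ} (c : BoundaryChart Ω) (y : Fin 3 → ℝ) : ℍ :=
  c.rot (point (c.height y) y)

/-- The density of the pullback of the 3-form `η` under the parametrisation:
`η (∂₀φ, ∂₁φ, ∂₂φ)` at `φ y`. The partial derivatives exist almost everywhere. -/
def BoundaryChart.pullback {Ω : Set ℍ} (c : BoundaryChart Ω) (η : ℍ → ℍ [⋀^Fin 3]→ₗ[ℝ] ℍ)
    (y : Fin 3 → ℝ) : ℍ :=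
  η (c.param y) (fun a => fderiv ℝ c.param y (Pi.single a 1))

/-- A bounded Lipschitz domain: a bounded connected open set whose boundary is locally the graph of
a Lipschitz function, with the set on one side of it. -/
structure IsLipschitzDomain (Ω : Set ℍ) : Prop where
  isOpen : IsOpen Ω
  isConnected : IsConnected Ω
  isBounded : Bornology.IsBounded Ω
  exists_chart : ∀ q ∈ frontier Ω, ∃ c : BoundaryChart Ω, q ∈ c.nbhd

/-- A finite family of boundary charts together with a smooth partition of unity on `∂Ω`
subordinate to it. -/
structure BoundaryAtlas (Ω : Set ℍ) (n : ℕ) where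
  chart : Fin n → BoundaryChart Ω
  weight : Fin n → ℍ → ℝ
  contDiff_weight : ∀ i, ContDiff ℝ ∞ (weight i)
  weight_nonneg : ∀ i q, 0 ≤ weight i q
  hasCompactSupport_weight : ∀ i, HasCompactSupport (weight i)
  tsupport_weight : ∀ i, tsupport (weight i) ⊆ (chart i).nbhd
  sum_weight : ∀ q ∈ frontier Ω, ∑ i, weight i q = 1

/-- `I` is the integral `∫_{∂Ω} η` of the 3-form `η` over the boundary of `Ω` with its boundary
orientation: finite atlases with a partition of unity exist, and through each of them the
localised pullbacks are integrable and their integrals add up to `I`. -/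
def HasBoundaryIntegral (Ω : Set ℍ) (η : ℍ → ℍ [⋀^Fin 3]→ₗ[ℝ] ℍ) (I : ℍ) : Prop :=
  (∃ n : ℕ, Nonempty (BoundaryAtlas Ω n)) ∧
    ∀ (n : ℕ) (A : BoundaryAtlas Ω n),
      (∀ i, Integrable (fun y => A.weight i ((A.chart i).param y) • (A.chart i).pullback η y)) ∧
      ∑ i, ∫ y, A.weight i ((A.chart i).param y) • (A.chart i).pullback η y = I

/-- The integral `∫_{∂Ω} η` exists. -/
def BoundaryIntegrable (Ω : Set ℍ) (η : ℍ → ℍ [⋀^Fin 3]→ₗ[ℝ] ℍ) : Prop :=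
  ∃ I : ℍ, HasBoundaryIntegral Ω η I

open Classical in
/-- The integral `∫_{∂Ω} η`, with value `0` where it does not exist. -/
def boundaryIntegral (Ω : Set ℍ) (η : ℍ → ℍ [⋀^Fin 3]→ₗ[ℝ] ℍ) : ℍ :=
  if h : BoundaryIntegrable Ω η then h.choose else 0

end

end QuatStokes

/-! Put `B = D̄F`. Since `D D̄ = D̄ D`, `B` is formally left-regular, and the Leibniz rule gives `∑
∂ₖ(F̄ eₖ B) = 2 F̄ (D B) + 2 (conj (D̄F)) B = 2 |B|²`. The divergence theorem turns this into the
claim, because `dσ` evaluated on tangent vectors of `∂Ω` is the outward normal. The difficulties are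
regularity: `F` is only `C¹`, so `B` is merely continuous, and `∂Ω` is only Lipschitz. For a cut-off
weight `w` supported in one chart, the field `v ↦ w F̄ v B` has the divergence `fluxDiv`, which
contains no derivative of `B`. The graph is lowered by a small amount, so that the relevant part of
the closed subgraph is a compact subset of `Ω`. There `F` is a `C¹` limit of smooth regular
functions (`exists_regular_approx`), for which the divergence theorem is
`integral_fluxDiv_subgraph_of_smooth`. Passing to the limit first in the approximation and then in
the height gives `BoundaryChart.integral_fluxDiv`. Globally, the weights of an atlas add up to one
only on `∂Ω`. The defect vanishes there and has no flux (`integral_fluxDiv_eq_zero`), so the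
localised boundary integrals always sum to `2 ∫ |B|²`, whatever the atlas. -/

namespace QuatStokes

/-! ### Divergence theorem below a Lipschitz graph, one partial derivative at a time. -/

section Graph

theorem hasCompactSupport_comp_graph {Y F : Type*} [TopologicalSpace Y] [R1Space Y] [Zero F] {f : ℝ × Y → F}
    (hc : HasCompactSupport f) (h : Y → ℝ) (t : ℝ) :
    HasCompactSupport (fun y => f (h y + t, y)) := by
  refine HasCompactSupport.intro (hc.isCompact.image continuous_snd) fun y hy => ?_
  by_contra hne
  exact hy ⟨_, subset_tsupport _ hne, rfl⟩

theorem hasCompactSupport_comp_shear {Y F : Type*} [TopologicalSpace Y] [R1Space Y] [Zero F] {f : ℝ × Y → F}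
    (hc : HasCompactSupport f) {h : Y → ℝ} (hh : Continuous h) :
    HasCompactSupport (fun p : ℝ × Y => f (h p.2 + p.1, p.2)) := by
  have hcont : Continuous fun p : ℝ × Y => (p.1 - h p.2, p.2) := by fun_prop
  refine HasCompactSupport.intro (hc.isCompact.image hcont) fun p hp => ?_
  by_contra hne
  exact hp ⟨_, subset_tsupport _ hne, by simp⟩

theorem integrable_comp_shear {Y E : Type*} [NormedAddCommGroup Y] [NormedSpace ℝ Y]
    [FiniteDimensional ℝ Y] [MeasurableSpace Y] [BorelSpace Y] {μ : Measure Y}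
    [μ.IsAddHaarMeasure] [NormedAddCommGroup E] {h : Y → ℝ} (hh : Continuous h) {g : ℝ × Y → E} (hg : Continuous g)
    (hc : HasCompactSupport g) :
    Integrable (fun p : ℝ × Y => g (h p.2 + p.1, p.2)) ((volume : Measure ℝ).prod μ) :=
  Continuous.integrable_of_hasCompactSupport (by fun_prop) (hasCompactSupport_comp_shear hc hh)

/-- Fubini and the fundamental theorem of calculus on each vertical half-line. The factor `m`,
constant on these lines, is there to be a derivative of `h` in the horizontal case. -/
theorem integral_fderiv_vertical_subgraph {Y E : Type*} [NormedAddCommGroup Y] [NormedSpace ℝ Y]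
    [MeasurableSpace Y] {μ : Measure Y} [SFinite μ] [NormedAddCommGroup E] [NormedSpace ℝ E]
    [FiniteDimensional ℝ E] {h : Y → ℝ}
    {f : ℝ × Y → E} (hf : ContDiff ℝ 1 f) (hc : HasCompactSupport f) (b : ℝ) (m : Y → ℝ)
    (hm : Integrable (fun p : ℝ × Y => m p.2 • fderiv ℝ f (h p.2 + p.1, p.2) (1, 0))
      ((volume : Measure ℝ).prod μ)) :
    ∫ p in Iic b ×ˢ univ, m p.2 • fderiv ℝ f (h p.2 + p.1, p.2) (1, 0)
        ∂((volume : Measure ℝ).prod μ)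
      = ∫ y, m y • f (h y + b, y) ∂μ := by
  rw [← Measure.prod_restrict, Measure.restrict_univ, integral_prod_symm]
  · refine integral_congr_ae (Eventually.of_forall fun y => ?_)
    simp only
    rw [integral_smul]
    congr 1
    have hline : ContDiff ℝ 1 (fun t : ℝ => f (h y + t, y)) := by fun_prop
    have hcs : HasCompactSupport (fun t : ℝ => f (h y + t, y)) := by
      have hcont : Continuous fun p : ℝ × Y => p.1 - h y := by fun_prop
      refine HasCompactSupport.intro (hc.isCompact.image hcont) fun t ht => ?_
      by_contra hne
      exact ht ⟨_, subset_tsupport _ hne, by simp⟩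
    rw [← hcs.integral_Iic_deriv_eq hline b]
    congr 1
    ext t
    have h1 : HasDerivAt (fun t : ℝ => (h y + t, y)) ((1 : ℝ), (0 : Y)) t :=
      ((hasDerivAt_id t).const_add (h y)).prodMk (hasDerivAt_const t y)
    exact (((hf.differentiable (by norm_num)) _).hasFDerivAt.comp_hasDerivAt t h1).deriv.symm
  · have := hm.restrict (s := Iic b ×ˢ univ)
    rwa [← Measure.prod_restrict, Measure.restrict_univ] at this

variable {Y : Type*} [NormedAddCommGroup Y] [NormedSpace ℝ Y] [FiniteDimensional ℝ Y]
  [MeasurableSpace Y] [BorelSpace Y] {μ : Measure Y} [μ.IsAddHaarMeasure]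
  {E : Type*} [NormedAddCommGroup E] [NormedSpace ℝ E] [FiniteDimensional ℝ E]

/-- Integration by parts against the constant `1` for real functions; continuous linear functionals
reduce the general case to this one. Rademacher's theorem identifies line derivatives with `fderiv`
almost everywhere. -/
theorem integral_fderiv_eq_zero_of_lipschitz {C : ℝ≥0} {u : Y → E} (hu : LipschitzWith C u)
    (hc : HasCompactSupport u) (v : Y) : ∫ y, fderiv ℝ u y v ∂μ = 0 := by
  have hreal : ∀ {C : ℝ≥0} {g : Y → ℝ}, LipschitzWith C g → HasCompactSupport g →
      ∫ y, fderiv ℝ g y v ∂μ = 0 := by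
    intro C g hg hgc
    have h := LipschitzWith.integral_lineDeriv_mul_eq (μ := μ)
      (LipschitzWith.const (1 : ℝ) : LipschitzWith 0 (fun _ : Y => (1 : ℝ))) hg hgc (-v)
    have h0 : ∀ x : Y, lineDeriv ℝ (fun _ : Y => (1 : ℝ)) x (-v) = 0 := fun x => by
      simp [lineDeriv]
    simp only [h0, zero_mul, integral_zero, neg_neg, mul_one] at h
    rw [h]
    refine integral_congr_ae ?_
    filter_upwards [hg.ae_differentiableAt (μ := μ)] with x hx
    exact hx.lineDeriv_eq_fderiv.symm
  have hint : Integrable (fun y => fderiv ℝ u y v) μ := by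
    borelize E
    have hcs : HasCompactSupport (fun y => fderiv ℝ u y v) := hc.fderiv_apply ℝ v
    refine (integrableOn_iff_integrable_of_support_subset (subset_tsupport _)).1 ?_
    refine Measure.integrableOn_of_bounded (M := C * ‖v‖) hcs.isCompact.measure_lt_top.ne
      (measurable_fderiv_apply_const ℝ u v).aestronglyMeasurable (Eventually.of_forall fun y => ?_)
    exact (fderiv ℝ u y).le_of_opNorm_le (norm_fderiv_le_of_lipschitz ℝ hu) v
  refine (SeparatingDual.eq_zero_iff_forall_dual_eq_zero (R := ℝ) _).2 fun ℓ => ?_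
  rw [← ContinuousLinearMap.integral_comp_comm ℓ hint]
  rw [← hreal (ℓ.lipschitz.comp hu) (hc.comp_left ℓ.map_zero)]
  refine integral_congr_ae ?_
  filter_upwards [hu.ae_differentiableAt (μ := μ)] with x hx
  rw [fderiv_comp x ℓ.differentiableAt hx]
  simp

theorem integrable_smul_of_lipschitz {Y E : Type*} [NormedAddCommGroup Y] [NormedSpace ℝ Y]
    [MeasurableSpace Y] [BorelSpace Y] {μ : Measure Y} [NormedAddCommGroup E] [NormedSpace ℝ E] {C : ℝ≥0} {h : Y → ℝ} (hh : LipschitzWith C h) (v : Y)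
    {g : Y → E} (hg : Integrable g μ) : Integrable (fun y => fderiv ℝ h y v • g y) μ := by
  refine hg.bdd_smul (C * ‖v‖)
    (measurable_fderiv_apply_const ℝ h v).aestronglyMeasurable (Eventually.of_forall fun y => ?_)
  exact (fderiv ℝ h y).le_of_opNorm_le (norm_fderiv_le_of_lipschitz ℝ hh) v

/-- The function `y ↦ f (h y + t, y)` is Lipschitz with compact support, so its derivative along `v`
has integral zero; the chain rule splits that derivative into the two integrands. -/
theorem integral_fderiv_horizontal_slice {C : ℝ≥0} {h : Y → ℝ} (hh : LipschitzWith C h)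
    {f : ℝ × Y → E} (hf : ContDiff ℝ 1 f) (hc : HasCompactSupport f) (v : Y) (t : ℝ) :
    ∫ y, fderiv ℝ f (h y + t, y) (0, v) ∂μ
      = - ∫ y, fderiv ℝ h y v • fderiv ℝ f (h y + t, y) (1, 0) ∂μ := by
  obtain ⟨D, hD⟩ := hf.lipschitzWith_of_hasCompactSupport hc (by norm_num)
  have hS : LipschitzWith (max (C + 0) 1) (fun y : Y => (h y + t, y)) :=
    (hh.add (LipschitzWith.const t)).prodMk LipschitzWith.id
  have hScont := hS.continuous
  have hint : ∀ z : ℝ × Y, Integrable (fun y => fderiv ℝ f (h y + t, y) z) μ := fun z =>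
    Continuous.integrable_of_hasCompactSupport
      (((hf.continuous_fderiv (by norm_num)).comp hScont).clm_apply continuous_const)
      (hasCompactSupport_comp_graph (hc.fderiv_apply ℝ z) h t)
  have h0 := integral_fderiv_eq_zero_of_lipschitz (μ := μ) (hD.comp hS)
    (hasCompactSupport_comp_graph hc h t) v
  rw [eq_neg_iff_add_eq_zero, ← integral_add (hint _) (integrable_smul_of_lipschitz hh v (hint _)),
    ← h0]
  refine integral_congr_ae ?_
  filter_upwards [hh.ae_differentiableAt (μ := μ)] with y hy
  have h1 : HasFDerivAt (fun y : Y => (h y + t, y))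
      ((fderiv ℝ h y).prod (ContinuousLinearMap.id ℝ Y)) y :=
    (hy.hasFDerivAt.add_const t).prodMk (hasFDerivAt_id y)
  have h2 := ((hf.differentiable (by norm_num)) (h y + t, y)).hasFDerivAt.comp (f := fun y => (h y + t, y)) y h1
  rw [h2.fderiv]
  simp only [ContinuousLinearMap.comp_apply, ContinuousLinearMap.prod_apply,
    ContinuousLinearMap.id_apply]
  rw [← map_smul, ← map_add]
  simp

/-- Integrating the slice identity over `t ≤ b` leaves a vertical derivative weighted by `∂ᵥh`, to
which the vertical case applies. -/
theorem integral_fderiv_horizontal_subgraph {C : ℝ≥0} {h : Y → ℝ} (hh : LipschitzWith C h)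
    {f : ℝ × Y → E} (hf : ContDiff ℝ 1 f) (hc : HasCompactSupport f) (v : Y) (b : ℝ) :
    ∫ p in Iic b ×ˢ univ, fderiv ℝ f (h p.2 + p.1, p.2) (0, v) ∂((volume : Measure ℝ).prod μ)
      = - ∫ y, fderiv ℝ h y v • f (h y + b, y) ∂μ := by
  have hint : ∀ z : ℝ × Y, Integrable (fun p : ℝ × Y => fderiv ℝ f (h p.2 + p.1, p.2) z)
      ((volume : Measure ℝ).prod μ) := fun z =>
    integrable_comp_shear hh.continuous
      ((hf.continuous_fderiv (by norm_num)).clm_apply continuous_const) (hc.fderiv_apply ℝ z)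
  have hm : Integrable (fun p : ℝ × Y =>
      fderiv ℝ h p.2 v • fderiv ℝ f (h p.2 + p.1, p.2) (1, 0)) ((volume : Measure ℝ).prod μ) := by
    refine (hint _).bdd_smul (C * ‖v‖)
      ((measurable_fderiv_apply_const ℝ h v).comp measurable_snd).aestronglyMeasurable
      (Eventually.of_forall fun y => ?_)
    exact (fderiv ℝ h y.2).le_of_opNorm_le (norm_fderiv_le_of_lipschitz ℝ hh) v
  have hres : ∀ {g : ℝ × Y → E}, Integrable g ((volume : Measure ℝ).prod μ) →
      Integrable g (((volume : Measure ℝ).restrict (Iic b)).prod μ) := fun {g} hg => by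
    have := hg.restrict (s := Iic b ×ˢ univ)
    rwa [← Measure.prod_restrict, Measure.restrict_univ] at this
  rw [← integral_fderiv_vertical_subgraph hf hc b _ hm, ← Measure.prod_restrict,
    Measure.restrict_univ, integral_prod _ (hres (hint _)), integral_prod _ (hres hm),
    ← integral_neg]
  exact integral_congr_ae (Eventually.of_forall fun t =>
    integral_fderiv_horizontal_slice hh hf hc v t)

end Graph

/-! ### Smooth approximation preserving a constant-coefficient equation. -/

section Mollification

open scoped Convolution Manifold

variable {E F : Type*} [NormedAddCommGroup E] [NormedSpace ℝ E] [FiniteDimensional ℝ E]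
  [NormedAddCommGroup F] [NormedSpace ℝ F]

/-- A function that is `C¹` on a neighbourhood of a compact set can be modified away from that set
so as to become `C¹` with compact support. -/
theorem exists_contDiff_hasCompactSupport_eqOn_thickening {Ω K : Set E} (hΩ : IsOpen Ω)
    (hK : IsCompact K) (hKΩ : K ⊆ Ω) {f : E → F} (hf : ContDiffOn ℝ 1 f Ω) :
    ∃ r > 0, ∃ g : E → F, Metric.thickening r K ⊆ Ω ∧ ContDiff ℝ 1 g ∧ HasCompactSupport g ∧
      EqOn g f (Metric.thickening r K) := by
  obtain ⟨r, hr, hrΩ⟩ := hK.exists_cthickening_subset_open hΩ hKΩ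
  obtain ⟨χ, hχ, -, hsupp, hone⟩ := exists_contMDiff_support_eq_eq_one_iff (n := ⊤) 𝓘(ℝ, E)
    (Metric.isOpen_thickening (δ := r) (E := K)) (Metric.isClosed_cthickening (δ := r / 2) (E := K))
    (Metric.cthickening_subset_thickening' hr (by linarith) K)
  have hχ1 : ContDiff ℝ 1 χ := (contMDiff_iff_contDiff.1 hχ).of_le (by exact_mod_cast le_top)
  have hts : tsupport χ ⊆ Metric.cthickening r K := by
    rw [tsupport, hsupp]; exact Metric.closure_thickening_subset_cthickening r K
  have hcs : HasCompactSupport χ := hK.cthickening.of_isClosed_subset (isClosed_tsupport χ) hts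
  have hsub : Metric.thickening (r / 2) K ⊆ Metric.cthickening (r / 2) K :=
    Metric.thickening_subset_cthickening _ _
  refine ⟨r / 2, by linarith, fun x => χ x • f x, hsub.trans
    ((Metric.cthickening_mono (by linarith) K).trans hrΩ), ?_, hcs.smul_right, fun x hx => ?_⟩
  · rw [contDiff_iff_contDiffAt]
    intro x
    by_cases hx : x ∈ tsupport χ
    · exact hχ1.contDiffAt.smul (hf.contDiffAt (hΩ.mem_nhds (hrΩ (hts hx))))
    · have h0 : (fun x => χ x • f x) =ᶠ[𝓝 x] fun _ => 0 := by
        filter_upwards [(isClosed_tsupport χ).isOpen_compl.mem_nhds hx] with y hy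
        rw [image_eq_zero_of_notMem_tsupport hy, zero_smul]
      exact contDiffAt_const.congr_of_eventuallyEq h0
  · simp only [(hone x).1 (hsub hx), one_smul]

/-- A `C¹` function on an open set whose derivative satisfies a linear equation with constant
coefficients is approximated in `C¹` on compact sets by smooth functions that satisfy the equation
nearby. -/
theorem exists_contDiff_approx_of_fderiv_constraint [CompleteSpace F] {F' : Type*}
    [NormedAddCommGroup F'] [NormedSpace ℝ F'] [CompleteSpace F'] {Ω K : Set E} (hΩ : IsOpen Ω)
    (hK : IsCompact K) (hKΩ : K ⊆ Ω) {f : E → F} (hf : ContDiffOn ℝ 1 f Ω)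
    (T : (E →L[ℝ] F) →L[ℝ] F') (hT : ∀ x ∈ Ω, T (fderiv ℝ f x) = 0) {ε : ℝ} (hε : 0 < ε) :
    ∃ g : E → F, ContDiff ℝ ∞ g ∧
      (∀ x ∈ K, ‖g x - f x‖ ≤ ε ∧ ‖fderiv ℝ g x - fderiv ℝ f x‖ ≤ ε) ∧
      ∀ x ∈ K, ∀ᶠ z in 𝓝 x, T (fderiv ℝ g z) = 0 := by
  borelize E
  let μ : Measure E := Measure.addHaar
  obtain ⟨r, hr, f₁, hrΩ, hf₁, hc, heq⟩ :=
    exists_contDiff_hasCompactSupport_eqOn_thickening hΩ hK hKΩ hf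
  have hfd : Continuous (fderiv ℝ f₁) := hf₁.continuous_fderiv (by norm_num)
  have heqd : ∀ x ∈ Metric.thickening r K, fderiv ℝ f₁ x = fderiv ℝ f x := fun x hx =>
    (heq.eventuallyEq_of_mem (Metric.isOpen_thickening.mem_nhds hx)).fderiv_eq
  obtain ⟨δ₁, hδ₁, h₁⟩ := Metric.uniformContinuous_iff.1
    (hc.uniformContinuous_of_continuous hf₁.continuous) ε hε
  obtain ⟨δ₂, hδ₂, h₂⟩ := Metric.uniformContinuous_iff.1
    ((hc.fderiv ℝ).uniformContinuous_of_continuous hfd) ε hε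
  -- Within distance `R`, both `f₁` and its derivative vary by less than `ε`, and the `r /
  -- 2`-neighbourhood of `K` stays inside its `r`-neighbourhood, where `f₁ = f`.
  let R := min (min δ₁ δ₂) (r / 2)
  have hR : 0 < R := by positivity
  let φ : ContDiffBump (0 : E) := ⟨R / 2, R, by linarith, by linarith⟩
  let L := ContinuousLinearMap.lsmul ℝ ℝ (E := F)
  have hder : ∀ x, HasFDerivAt (φ.normed μ ⋆[L, μ] f₁)
      ((φ.normed μ ⋆[ContinuousLinearMap.lsmul ℝ ℝ (E := E →L[ℝ] F), μ] fderiv ℝ f₁) x) x :=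
    fun x => hc.hasFDerivAt_convolution_right L φ.continuous_normed.locallyIntegrable hf₁ x
  refine ⟨φ.normed μ ⋆[L, μ] f₁, ?_, fun x hx => ?_, fun x hx => ?_⟩
  · exact φ.hasCompactSupport_normed.contDiff_convolution_left L φ.contDiff_normed
      hf₁.continuous.locallyIntegrable
  · have hx' := Metric.self_subset_thickening hr K hx
    rw [(hder x).fderiv, ← heq hx', ← heqd x hx', ← dist_eq_norm, ← dist_eq_norm]
    refine ⟨φ.dist_normed_convolution_le hf₁.continuous.aestronglyMeasurable fun y hy => ?_,
      φ.dist_normed_convolution_le hfd.aestronglyMeasurable fun y hy => ?_⟩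
    · exact (h₁ (lt_of_lt_of_le hy ((min_le_left _ _).trans (min_le_left _ _)))).le
    · exact (h₂ (lt_of_lt_of_le hy ((min_le_left _ _).trans (min_le_right _ _)))).le
  · have hnhds : Metric.thickening (r / 2) K ∈ 𝓝 x :=
      Metric.isOpen_thickening.mem_nhds (Metric.self_subset_thickening (by linarith) K hx)
    filter_upwards [hnhds] with z hz
    have hint : ConvolutionExistsAt (φ.normed μ) (fderiv ℝ f₁) z
        (ContinuousLinearMap.lsmul ℝ ℝ (E := E →L[ℝ] F)) μ :=
      φ.hasCompactSupport_normed.convolutionExists_left _ φ.continuous_normed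
        hfd.locallyIntegrable z
    -- `T` does not depend on the point, so it passes under the convolution integral and meets only
    -- derivatives of `f` at points of `Ω`.
    rw [(hder z).fderiv, convolution_def, ← ContinuousLinearMap.integral_comp_comm T hint]
    refine integral_eq_zero_of_ae (Eventually.of_forall fun t => ?_)
    simp only [ContinuousLinearMap.lsmul_apply, map_smul, Pi.zero_apply]
    by_cases ht : t ∈ Function.support (φ.normed μ)
    · rw [φ.support_normed_eq, mem_ball_zero_iff] at ht
      have hzt : z - t ∈ Metric.thickening r K := by
        obtain ⟨k, hk, hzk⟩ := Metric.mem_thickening_iff.1 hz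
        refine Metric.mem_thickening_iff.2 ⟨k, hk, ?_⟩
        have h3 : dist (z - t) z = ‖t‖ := by rw [dist_eq_norm]; simp
        have h4 : ‖t‖ < r / 2 := lt_of_lt_of_le ht (min_le_right _ _)
        linarith [dist_triangle (z - t) z k]
      rw [heqd _ hzt, hT _ (hrΩ hzt), smul_zero]
    · rw [Function.notMem_support.1 ht, zero_smul]

end Mollification

/-! ### Quaternionic identities: `D D̄ = D̄ D`, the divergence of the flux field, and `dσ` as a
normal vector. -/

section Algebra

instance : StarModule ℝ ℍ := ⟨fun c q => by simp [Quaternion.star_smul]⟩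

@[simp] theorem qunit_re (k : Fin 4) : (qunit k).re = ![1, 0, 0, 0] k := by fin_cases k <;> rfl
@[simp] theorem qunit_imI (k : Fin 4) : (qunit k).imI = ![0, 1, 0, 0] k := by fin_cases k <;> rfl
@[simp] theorem qunit_imJ (k : Fin 4) : (qunit k).imJ = ![0, 0, 1, 0] k := by fin_cases k <;> rfl
@[simp] theorem qunit_imK (k : Fin 4) : (qunit k).imK = ![0, 0, 0, 1] k := by fin_cases k <;> rfl

/-- Both sides are twice the inner product of the two units, by polarising `q q̄ = q̄ q`. -/
theorem qunit_mul_star_symm (k j : Fin 4) :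
    qunit k * star (qunit j) + qunit j * star (qunit k)
      = star (qunit k) * qunit j + star (qunit j) * qunit k := by
  ext <;> simp <;> ring

/-- The units `1, i, j, k` as an orthonormal basis. -/
noncomputable def quatBasis : OrthonormalBasis (Fin 4) ℝ ℍ :=
  (EuclideanSpace.basisFun (Fin 4) ℝ).map Quaternion.linearIsometryEquivTuple.symm

theorem quatBasis_apply (k : Fin 4) : quatBasis k = qunit k := by
  fin_cases k <;> ext <;> simp [quatBasis, qunit]

/-- The trace of a bilinear map is its value on the canonical tensor `∑ bₖ ⊗ bₖ`, which is the same
for every orthonormal basis. This lets divergences be computed in the rotated frame of a chart. -/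
theorem sum_bilinear_orthonormal {ι M : Type*} [Fintype ι] [AddCommGroup M] [Module ℝ M]
    (T : ℍ →ₗ[ℝ] ℍ →ₗ[ℝ] M) (b : OrthonormalBasis ι ℝ ℍ) :
    ∑ k, T (b k) (b k) = ∑ k, T (qunit k) (qunit k) := by
  have h := (InnerProductSpace.canonicalCovariantTensor_eq_sum ℍ b).symm.trans
    (InnerProductSpace.canonicalCovariantTensor_eq_sum ℍ quatBasis)
  simpa [quatBasis_apply] using congrArg (TensorProduct.lift T) h

theorem sum_bilinear_rot {M : Type*} [AddCommGroup M] [Module ℝ M]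
    (T : ℍ →ₗ[ℝ] ℍ →ₗ[ℝ] M) (R : ℍ ≃ₗᵢ[ℝ] ℍ) :
    ∑ k, T (R (qunit k)) (R (qunit k)) = ∑ k, T (qunit k) (qunit k) := by
  simpa [quatBasis_apply] using sum_bilinear_orthonormal T (quatBasis.map R)

/-- Algebraic form of `D D̄ = D̄ D`, with `H` the matrix of second partial derivatives. Only the
symmetrised coefficients matter, and those agree by `qunit_mul_star_symm`. -/
theorem sum_qunit_mul_star_of_symm (H : Fin 4 → Fin 4 → ℍ) (hH : ∀ k j, H k j = H j k) :
    ∑ k, ∑ j, qunit k * (star (qunit j) * H k j) = ∑ k, ∑ j, star (qunit k) * (qunit j * H k j) := by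
  have key : ∀ P : Fin 4 → Fin 4 → ℍ, (2 : ℝ) • ∑ k, ∑ j, P k j * H k j
      = ∑ k, ∑ j, (P k j + P j k) * H k j := fun P => by
    have hswap : ∑ k, ∑ j, P k j * H k j = ∑ k, ∑ j, P j k * H k j := by
      rw [Finset.sum_comm]
      simp_rw [hH]
    simp_rw [add_mul, Finset.sum_add_distrib]
    rw [← hswap, two_smul]
  have h1 := key fun k j => qunit k * star (qunit j)
  have h2 := key fun k j => star (qunit k) * qunit j
  simp only [qunit_mul_star_symm] at h1
  rw [← h2] at h1
  simpa only [mul_assoc] using smul_right_injective ℍ (two_ne_zero (α := ℝ)) h1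

/-- The operator `D` as a linear function of the derivative. -/
noncomputable def dOp : (ℍ →L[ℝ] ℍ) →L[ℝ] ℍ :=
  (1 / 2 : ℝ) • ∑ k : Fin 4,
    (ContinuousLinearMap.mul ℝ ℍ (qunit k)).comp (ContinuousLinearMap.apply ℝ ℍ (qunit k))

/-- The operator `D̄` as a linear function of the derivative. -/
noncomputable def dbarOp : (ℍ →L[ℝ] ℍ) →L[ℝ] ℍ :=
  (1 / 2 : ℝ) • ∑ k : Fin 4,
    (ContinuousLinearMap.mul ℝ ℍ (star (qunit k))).comp (ContinuousLinearMap.apply ℝ ℍ (qunit k))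

theorem dOp_apply (A : ℍ →L[ℝ] ℍ) : dOp A = (1 / 2 : ℝ) • ∑ k, qunit k * A (qunit k) := by
  simp [dOp]

theorem dbarOp_apply (A : ℍ →L[ℝ] ℍ) :
    dbarOp A = (1 / 2 : ℝ) • ∑ k, star (qunit k) * A (qunit k) := by
  simp [dbarOp]

theorem fueterD_eq_dOp (F : ℍ → ℍ) (q : ℍ) : fueterD F q = dOp (fderiv ℝ F q) :=
  (dOp_apply _).symm

theorem fueterDbar_eq_dbarOp (F : ℍ → ℍ) (q : ℍ) : fueterDbar F q = dbarOp (fderiv ℝ F q) :=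
  (dbarOp_apply _).symm

theorem contDiff_fueterDbar {g : ℍ → ℍ} (hg : ContDiff ℝ ∞ g) : ContDiff ℝ ∞ (fueterDbar g) := by
  have : fueterDbar g = fun q => dbarOp (fderiv ℝ g q) := funext (fueterDbar_eq_dbarOp g)
  rw [this]
  exact dbarOp.contDiff.comp (hg.fderiv_right (m := ∞) (by simp))

theorem fderiv_clm_comp {X V W : Type*} [NormedAddCommGroup X] [NormedSpace ℝ X]
    [NormedAddCommGroup V] [NormedSpace ℝ V] [NormedAddCommGroup W] [NormedSpace ℝ W]
    (T : V →L[ℝ] W) {f : X → V} {x : X} (hf : DifferentiableAt ℝ f x) :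
    fderiv ℝ (fun z => T (f z)) x = T.comp (fderiv ℝ f x) :=
  (T.hasFDerivAt.comp x hf.hasFDerivAt).fderiv

/-- Since `D D̄ = D̄ D`, the function `D̄ g` is left-regular where `g` is. -/
theorem fueterD_fueterDbar_eq_zero {g : ℍ → ℍ} (hg : ContDiff ℝ ∞ g) {x : ℍ}
    (h : ∀ᶠ z in 𝓝 x, fueterD g z = 0) : fueterD (fueterDbar g) x = 0 := by
  have hd : DifferentiableAt ℝ (fderiv ℝ g) x :=
    ((hg.fderiv_right (m := ∞) (by simp)).differentiable (by simp)) x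
  have hop : ∀ T : (ℍ →L[ℝ] ℍ) →L[ℝ] ℍ,
      fderiv ℝ (fun z => T (fderiv ℝ g z)) x = T.comp (fderiv ℝ (fderiv ℝ g) x) := fun T =>
    fderiv_clm_comp T (f := fderiv ℝ g) hd
  -- Symmetry of the second derivative is where smoothness of `g` enters.
  have hsymm : ∀ u v, fderiv ℝ (fderiv ℝ g) x u v = fderiv ℝ (fderiv ℝ g) x v u := fun u v =>
    (hg.contDiffAt (x := x)).isSymmSndFDerivAt
      (by rw [minSmoothness_of_isRCLikeNormedField]; exact WithTop.coe_le_coe.2 (le_top : (2 : ℕ∞) ≤ ⊤)) u v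
  have h0 : fderiv ℝ (fun z => dOp (fderiv ℝ g z)) x = 0 := by
    have h1 : (fun z => dOp (fderiv ℝ g z)) =ᶠ[𝓝 x] fun _ => 0 := by
      filter_upwards [h] with z hz
      rw [← fueterD_eq_dOp, hz]
    rw [h1.fderiv_eq, fderiv_fun_const]; rfl
  have h2 : dbarOp (fderiv ℝ (fun z => dOp (fderiv ℝ g z)) x) = 0 := by rw [h0, map_zero]
  have h3 : fueterDbar g = fun q => dbarOp (fderiv ℝ g q) := funext (fueterDbar_eq_dbarOp g)
  rw [fueterD_eq_dOp, h3, hop, dOp_apply]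
  rw [hop, dbarOp_apply] at h2
  simp only [ContinuousLinearMap.comp_apply, dOp_apply, dbarOp_apply, mul_smul_comm,
    Finset.mul_sum, ← Finset.smul_sum] at h2 ⊢
  rw [sum_qunit_mul_star_of_symm _ fun k j => hsymm _ _, h2]

/-- The gradient `∑ ∂_k w e_k`. -/
noncomputable def quatGrad (w : ℍ → ℝ) (x : ℍ) : ℍ := ∑ k, fderiv ℝ w x (qunit k) • qunit k

/-- The divergence `2 w |B|² + Ā ∇w B` of the field `v ↦ w Ā v B`, for regular `A` and `B = D̄ A`. -/
noncomputable def fluxDiv (w : ℍ → ℝ) (A B : ℍ → ℍ) (x : ℍ) : ℍ :=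
  w x • ((2 * ‖B x‖ ^ 2 : ℝ) : ℍ) + star (A x) * quatGrad w x * B x

theorem sum_fderiv_flux (R : ℍ ≃ₗᵢ[ℝ] ℍ) {w : ℍ → ℝ} (hw : ContDiff ℝ 1 w) {g : ℍ → ℍ}
    (hg : ContDiff ℝ ∞ g) {x : ℍ} (h : ∀ᶠ z in 𝓝 x, fueterD g z = 0) :
    ∑ k, fderiv ℝ (fun z => w z • (star (g z) * R (qunit k) * fueterDbar g z)) x (R (qunit k))
      = fluxDiv w g (fueterDbar g) x := by
  set B := fueterDbar g with hB
  have hwd := (hw.differentiable (by norm_num) x).hasFDerivAt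
  have hgd := (hg.differentiable (by simp) x).hasFDerivAt
  have hBd := ((contDiff_fueterDbar hg).differentiable (by simp) x).hasFDerivAt
  rw [← hB] at hBd
  have hfd : ∀ v u : ℍ, fderiv ℝ (fun z => w z • (star (g z) * v * B z)) x u
      = w x • (star (g x) * v * fderiv ℝ B x u + star (fderiv ℝ g x u) * v * B x)
        + fderiv ℝ w x u • (star (g x) * v * B x) := fun v u => by
    have h1 := hwd.smul (((hgd.star).mul_const' v).mul' hBd)
    have h2 := h1.fderiv
    have h3 : fderiv ℝ (fun z => w z • (star (g z) * v * B z)) x = _ := h2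
    rw [h3]
    simp
  -- The Leibniz expansion is bilinear in the inserted vector `v` and the direction `u`, so its
  -- trace in the frame `R eₖ` equals the one in the standard frame.
  let T : ℍ →ₗ[ℝ] ℍ →ₗ[ℝ] ℍ := LinearMap.mk₂ ℝ
    (fun v u => w x • (star (g x) * v * fderiv ℝ B x u + star (fderiv ℝ g x u) * v * B x)
        + fderiv ℝ w x u • (star (g x) * v * B x))
    (fun v v' u => by simp only [mul_add, add_mul, smul_add]; abel)
    (fun c v u => by
      simp only [mul_smul_comm, smul_mul_assoc, smul_add, smul_comm c])
    (fun v u u' => by simp only [map_add, star_add, mul_add, add_mul, smul_add, add_smul]; abel)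
    (fun c v u => by
      simp only [map_smul, star_smul, star_trivial, mul_smul_comm, smul_mul_assoc, smul_add,
        smul_comm c, smul_eq_mul, mul_smul])
  have hT := sum_bilinear_rot T R
  simp only [T, LinearMap.mk₂_apply] at hT
  simp only [hfd]
  rw [hT]
  have hDB : ∑ k, qunit k * fderiv ℝ B x (qunit k) = 0 := by
    have := fueterD_fueterDbar_eq_zero hg h
    rw [fueterD_eq_dOp, dOp_apply] at this
    exact (smul_eq_zero.1 this).resolve_left (by norm_num)
  have hBg : ∑ k, star (fderiv ℝ g x (qunit k)) * qunit k = (2 : ℝ) • star (B x) := by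
    rw [hB, fueterDbar_eq_dbarOp, dbarOp_apply]
    simp [star_sum, star_smul, smul_smul]
  have hBB : star (B x) * B x = ((‖B x‖ ^ 2 : ℝ) : ℍ) := by
    rw [Quaternion.star_mul_self, Quaternion.normSq_eq_norm_mul_self, sq]
  simp only [Finset.sum_add_distrib, ← Finset.smul_sum, mul_assoc, ← Finset.mul_sum, hDB]
  simp only [← mul_assoc, ← Finset.sum_mul, hBg]
  rw [mul_zero, zero_add, smul_mul_assoc, hBB, fluxDiv, quatGrad]
  congr 1
  · rw [Quaternion.coe_mul, ← Quaternion.coe_mul_eq_smul 2]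
  · simp only [Finset.mul_sum, Finset.sum_mul, mul_smul_comm, smul_mul_assoc]

theorem dx_apply (k : Fin 4) (q : ℍ) : dx k q = ![q.re, q.imI, q.imJ, q.imK] k := by
  fin_cases k <;> rfl

theorem dxWedge_apply (a b c : Fin 4) (v : Fin 3 → ℍ) :
    dxWedge a b c v = Matrix.det (Matrix.of fun i => ![dx a (v i), dx b (v i), dx c (v i)]) := by
  change Matrix.det (fun i => LinearMap.pi ![dx a, dx b, dx c] (v i)) = _
  congr 1
  ext i j
  fin_cases j <;> rfl

theorem dsigma_apply (v : Fin 3 → ℍ) :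
    dsigma v = dxWedge 1 2 3 v • qunit 0 - dxWedge 0 2 3 v • qunit 1 + dxWedge 0 1 3 v • qunit 2
      - dxWedge 0 1 2 v • qunit 3 := rfl

/-- This exhibits `dsigma` as the triple cross product of four-dimensional space, whence its
equivariance under rotations. -/
theorem inner_dsigma (v : Fin 3 → ℍ) (u : ℍ) :
    inner ℝ u (dsigma v)
      = (QuaternionAlgebra.basisOneIJK (-1 : ℝ) 0 (-1)).det (Matrix.vecCons u v) := by
  have h : (QuaternionAlgebra.basisOneIJK (-1 : ℝ) 0 (-1)).toMatrix (Matrix.vecCons u v)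
      = Matrix.of fun k j => dx k (Matrix.vecCons u v j) := by
    ext k j; rfl
  rw [Module.Basis.det_apply, h, Matrix.det_succ_row_zero]
  simp [Fin.sum_univ_succ, Matrix.det_fin_three, dsigma_apply, dxWedge_apply, dx_apply,
    Quaternion.inner_def, Fin.succAbove]
  ring

/-- A rotation preserves inner products and, having determinant one, also the determinant that
characterises `dsigma` through `inner_dsigma`. -/
theorem dsigma_rot (R : ℍ ≃ₗᵢ[ℝ] ℍ) (hR : LinearMap.det (R.toLinearEquiv : ℍ →ₗ[ℝ] ℍ) = 1)
    (v : Fin 3 → ℍ) : dsigma (fun a => R (v a)) = R (dsigma v) := by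
  refine ext_inner_left ℝ fun u => ?_
  obtain ⟨u, rfl⟩ := R.surjective u
  rw [R.inner_map_map, inner_dsigma, inner_dsigma]
  have h := Module.Basis.det_comp (QuaternionAlgebra.basisOneIJK (-1 : ℝ) 0 (-1))
    (R.toLinearEquiv : ℍ →ₗ[ℝ] ℍ) (Matrix.vecCons u v)
  have h' := h.trans (congrArg (fun d : ℝ => d *
    (QuaternionAlgebra.basisOneIJK (-1 : ℝ) 0 (-1)).det (Matrix.vecCons u v)) hR)
  simp only [one_mul] at h'
  rw [← h']
  congr 1
  ext i : 1
  refine Fin.cases rfl (fun i => rfl) i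

@[simp] theorem point_re (s : ℝ) (y : Fin 3 → ℝ) : (point s y).re = s := rfl
@[simp] theorem point_imI (s : ℝ) (y : Fin 3 → ℝ) : (point s y).imI = y 0 := rfl
@[simp] theorem point_imJ (s : ℝ) (y : Fin 3 → ℝ) : (point s y).imJ = y 1 := rfl
@[simp] theorem point_imK (s : ℝ) (y : Fin 3 → ℝ) : (point s y).imK = y 2 := rfl

/-- The signs in `dσ` produce the normal `(1, -∇h)` pointing upwards, which is outward for a domain
below the graph. -/
theorem dsigma_graph_tangent (d : Fin 3 → ℝ) :
    dsigma (fun a => point (d a) (Pi.single a 1)) = point 1 (-d) := by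
  ext <;> simp [dsigma_apply, dxWedge_apply, dx_apply, Matrix.det_fin_three]

end Algebra

/-! ### Rotated coordinates flattening the graph. -/

section Coordinates

theorem point_eq_sum (s : ℝ) (y : Fin 3 → ℝ) :
    point s y = s • qunit 0 + ∑ a, y a • qunit a.succ := by
  ext <;> simp [Fin.sum_univ_succ]

/-- Cartesian coordinates `(s, y) ↦ s + y₀ i + y₁ j + y₂ k`. -/
noncomputable def pointEquiv : (ℝ × (Fin 3 → ℝ)) ≃L[ℝ] ℍ :=
  LinearEquiv.toContinuousLinearEquiv
    { toFun := fun p => point p.1 p.2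
      invFun := fun q => (q.re, ![q.imI, q.imJ, q.imK])
      map_add' := fun p q => by ext <;> simp
      map_smul' := fun c p => by ext <;> simp
      left_inv := fun p => by
        refine Prod.ext rfl (funext fun a => ?_)
        fin_cases a <;> rfl
      right_inv := fun q => rfl }

theorem measurePreserving_pointEquiv : MeasurePreserving pointEquiv := by
  have h1 := ((volume_preserving_piFinSuccAbove (fun _ : Fin 4 => ℝ) 0).symm)
  have h2 := PiLp.volume_preserving_toLp (Fin 4)
  have h3 := Quaternion.linearIsometryEquivTuple.symm.measurePreserving
  exact h3.comp (h2.comp h1)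

/-- Rotated Cartesian coordinates. -/
noncomputable def rotEquiv (R : ℍ ≃ₗᵢ[ℝ] ℍ) : (ℝ × (Fin 3 → ℝ)) ≃L[ℝ] ℍ :=
  pointEquiv.trans R.toContinuousLinearEquiv

@[simp] theorem rotEquiv_apply (R : ℍ ≃ₗᵢ[ℝ] ℍ) (p : ℝ × (Fin 3 → ℝ)) :
    rotEquiv R p = R (point p.1 p.2) := rfl

/-- Coordinates `(t, y) ↦ R (h y + t, y)` that flatten the graph of `h`. -/
noncomputable def graphMap (R : ℍ ≃ₗᵢ[ℝ] ℍ) (h : (Fin 3 → ℝ) → ℝ) (p : ℝ × (Fin 3 → ℝ)) : ℍ :=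
  rotEquiv R (h p.2 + p.1, p.2)

variable {R : ℍ ≃ₗᵢ[ℝ] ℍ} {h : (Fin 3 → ℝ) → ℝ}

theorem continuous_graphMap (hh : Continuous h) : Continuous (graphMap R h) :=
  (rotEquiv R).continuous.comp (by fun_prop)

theorem graphMap_surjective (x : ℍ) : ∃ p, graphMap R h p = x := by
  refine ⟨(((rotEquiv R).symm x).1 - h ((rotEquiv R).symm x).2, ((rotEquiv R).symm x).2), ?_⟩
  simp only [graphMap, add_sub_cancel]
  exact (rotEquiv R).apply_symm_apply x

/-- The shear translates every vertical line, so continuity of `h` suffices and no Jacobian is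
needed. -/
theorem measurePreserving_graphMap (hh : Continuous h) : MeasurePreserving (graphMap R h) := by
  have h1 : MeasurePreserving (fun p : (Fin 3 → ℝ) × ℝ => (p.1, h p.1 + p.2)) :=
    (MeasurePreserving.id (volume : Measure (Fin 3 → ℝ))).skew_product
      (g := fun y t => h y + t) (by fun_prop)
      (Eventually.of_forall fun y => (measurePreserving_add_left volume (h y)).map_eq)
  have hswap : MeasurePreserving (Prod.swap : ℝ × (Fin 3 → ℝ) → (Fin 3 → ℝ) × ℝ) :=
    Measure.measurePreserving_swap
  have hswap' : MeasurePreserving (Prod.swap : (Fin 3 → ℝ) × ℝ → ℝ × (Fin 3 → ℝ)) :=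
    Measure.measurePreserving_swap
  exact R.measurePreserving.comp
    (measurePreserving_pointEquiv.comp (hswap'.comp (h1.comp hswap)))

theorem hasCompactSupport_comp_graphMap {M : Type*} [Zero M] (hh : Continuous h) {f : ℍ → M}
    (hf : HasCompactSupport f) : HasCompactSupport (fun p => f (graphMap R h p)) :=
  hasCompactSupport_comp_shear (f := fun p => f (rotEquiv R p))
    (hf.comp_homeomorph (rotEquiv R).toHomeomorph) hh

/-- Integrals in flattening coordinates. -/
theorem integral_comp_graphMap (hh : Continuous h) (f : ℍ → ℍ) :
    ∫ p, f (graphMap R h p) = ∫ x, f x := by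
  refine (measurePreserving_graphMap hh).integral_comp ?_ f
  let e : ℝ × (Fin 3 → ℝ) ≃ₜ ℝ × (Fin 3 → ℝ) :=
    { toFun := fun p => (h p.2 + p.1, p.2)
      invFun := fun p => (p.1 - h p.2, p.2)
      left_inv := fun p => by simp
      right_inv := fun p => by simp
      continuous_toFun := by fun_prop
      continuous_invFun := by fun_prop }
  exact (e.trans (rotEquiv R).toHomeomorph).measurableEmbedding

/-- The vertical identity for `W 0` and the horizontal ones for the other components, added up: the
right-hand side pairs the field with the normal `(1, -∇h)`. -/
theorem integral_div_subgraph {C : ℝ≥0} (hh : LipschitzWith C h) {W : Fin 4 → ℍ → ℍ}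
    (hW : ∀ k, ContDiff ℝ 1 (W k)) (hc : ∀ k, HasCompactSupport (W k)) (b : ℝ) :
    ∫ p in Iic b ×ˢ univ, ∑ k, fderiv ℝ (W k) (graphMap R h p) (R (qunit k))
      = ∫ y, (W 0 (graphMap R h (b, y))
          - ∑ a : Fin 3, fderiv ℝ h y (Pi.single a 1) • W a.succ (graphMap R h (b, y))) := by
  let f : Fin 4 → ℝ × (Fin 3 → ℝ) → ℍ := fun k p => W k (rotEquiv R p)
  have hf : ∀ k, ContDiff ℝ 1 (f k) := fun k => (hW k).comp (rotEquiv R).contDiff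
  have hfc : ∀ k, HasCompactSupport (f k) := fun k =>
    (hc k).comp_homeomorph (rotEquiv R).toHomeomorph
  have hfd : ∀ k p z, fderiv ℝ (W k) (rotEquiv R p) (rotEquiv R z) = fderiv ℝ (f k) p z :=
    fun k p z => by
      have h1 := (((hW k).differentiable (by norm_num)) (rotEquiv R p)).hasFDerivAt.comp p
        (rotEquiv R).hasFDerivAt
      have h2 : fderiv ℝ (f k) p = _ := h1.fderiv
      rw [h2]; rfl
  have hint : ∀ k z, Integrable (fun p : ℝ × (Fin 3 → ℝ) =>
      fderiv ℝ (W k) (graphMap R h p) (rotEquiv R z)) := fun k z => by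
    simp only [graphMap, hfd]
    exact integrable_comp_shear hh.continuous
      (((hf k).continuous_fderiv (by norm_num)).clm_apply continuous_const)
      ((hfc k).fderiv_apply ℝ z)
  have hR0 : R (qunit 0) = rotEquiv R (1, 0) := by
    rw [rotEquiv_apply]; congr 1
  have hRa : ∀ a : Fin 3, R (qunit a.succ) = rotEquiv R (0, Pi.single a 1) := fun a => by
    rw [rotEquiv_apply]; congr 1; fin_cases a <;> ext <;> simp
  have hvert := integral_fderiv_vertical_subgraph (μ := (volume : Measure (Fin 3 → ℝ))) (h := h)
    (hf 0) (hfc 0) b (fun _ => 1) (by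
      simp only [one_smul]
      have := hint 0 (1, 0)
      simp only [graphMap, hfd] at this
      exact this)
  have hhor := fun a : Fin 3 => integral_fderiv_horizontal_subgraph
    (μ := (volume : Measure (Fin 3 → ℝ))) hh (hf a.succ) (hfc a.succ) (Pi.single a 1) b
  have hWint : ∀ k, Integrable (fun y : Fin 3 → ℝ => W k (graphMap R h (b, y))) := fun k => by
    refine Continuous.integrable_of_hasCompactSupport
      ((hW k).continuous.comp ((continuous_graphMap hh.continuous).comp (by fun_prop))) ?_
    exact hasCompactSupport_comp_graph (hfc k) h b
  simp only [Fin.sum_univ_succ (n := 3), hR0, hRa]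
  rw [integral_add (hint _ _).integrableOn
    (integrable_finsetSum _ fun a _ => (hint _ _).integrableOn),
    integral_finsetSum _ fun a _ => (hint _ _).integrableOn,
    integral_sub (hWint 0)
      (integrable_finsetSum _ fun a _ => integrable_smul_of_lipschitz hh _ (hWint _)),
    integral_finsetSum _ fun a _ => integrable_smul_of_lipschitz hh _ (hWint _), sub_eq_add_neg,
    ← Finset.sum_neg_distrib]
  congr 1
  · simp only [one_smul] at hvert
    simp only [graphMap, hfd]
    exact hvert
  · refine Finset.sum_congr rfl fun a _ => ?_
    simp only [graphMap, hfd]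
    exact hhor a

end Coordinates

/-! ### The flux field below a graph, for smooth and then for `C¹` regular functions. -/

section Flux

/-- The (non-normalised) outward normal `R (1, -∇h)` to the graph of `h`. -/
noncomputable def graphNormal (R : ℍ ≃ₗᵢ[ℝ] ℍ) (h : (Fin 3 → ℝ) → ℝ) (y : Fin 3 → ℝ) : ℍ :=
  R (point 1 (fun a => -fderiv ℝ h y (Pi.single a 1)))

variable {R : ℍ ≃ₗᵢ[ℝ] ℍ} {h : (Fin 3 → ℝ) → ℝ}

theorem graphNormal_eq (y : Fin 3 → ℝ) : graphNormal R h y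
    = R (qunit 0) - ∑ a : Fin 3, fderiv ℝ h y (Pi.single a 1) • R (qunit a.succ) := by
  simp [graphNormal, point_eq_sum, sub_eq_add_neg]

theorem measurable_graphNormal : Measurable (graphNormal R h) :=
  (rotEquiv R).continuous.measurable.comp (measurable_const.prodMk
    (measurable_pi_lambda _ fun a => (measurable_fderiv_apply_const ℝ h (Pi.single a 1)).neg))

theorem exists_norm_graphNormal_le {C : ℝ≥0} (hh : LipschitzWith C h) :
    ∃ M, ∀ y, ‖graphNormal R h y‖ ≤ M := by
  refine ⟨‖((rotEquiv R : (ℝ × (Fin 3 → ℝ)) ≃L[ℝ] ℍ) : (ℝ × (Fin 3 → ℝ)) →L[ℝ] ℍ)‖ * max 1 C,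
    fun y => ?_⟩
  refine ContinuousLinearMap.le_of_opNorm_le_of_le
    ((rotEquiv R : (ℝ × (Fin 3 → ℝ)) ≃L[ℝ] ℍ) : (ℝ × (Fin 3 → ℝ)) →L[ℝ] ℍ)
    (x := (1, fun a => -fderiv ℝ h y (Pi.single a 1))) le_rfl ?_
  rw [Prod.norm_def]
  refine max_le_max (by simp) ((pi_norm_le_iff_of_nonneg C.2).2 fun a => ?_)
  rw [norm_neg]
  have h1 := (fderiv ℝ h y).le_of_opNorm_le (norm_fderiv_le_of_lipschitz ℝ hh) (Pi.single a 1)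
  simpa [Pi.norm_single] using h1

theorem integrable_flux {C : ℝ≥0} (hh : LipschitzWith C h) {m : (Fin 3 → ℝ) → ℝ}
    (hm : Continuous m) (hmc : HasCompactSupport m) {a b : (Fin 3 → ℝ) → ℍ} (ha : Continuous a)
    (hb : Continuous b) :
    Integrable (fun y => m y • (star (a y) * graphNormal R h y * b y)) := by
  obtain ⟨M, hM⟩ := exists_norm_graphNormal_le (R := R) hh
  have hbd : Integrable (fun y => |m y| * (‖a y‖ * M * ‖b y‖)) :=
    Continuous.integrable_of_hasCompactSupport (by fun_prop)
      ((hmc.comp_left (g := fun t : ℝ => |t|) abs_zero).mul_right)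
  refine hbd.mono' ?_ (Eventually.of_forall fun y => ?_)
  · exact hm.aestronglyMeasurable.smul ((ha.star.aestronglyMeasurable.mul
      measurable_graphNormal.aestronglyMeasurable).mul hb.aestronglyMeasurable)
  · rw [norm_smul, norm_mul, norm_mul, norm_star, Real.norm_eq_abs]
    gcongr
    exact hM y

theorem continuous_quatGrad {w : ℍ → ℝ} (hw : ContDiff ℝ 1 w) : Continuous (quatGrad w) :=
  continuous_finsetSum _ fun k _ =>
    ((hw.continuous_fderiv (by norm_num)).clm_apply continuous_const).smul continuous_const

theorem quatGrad_eq_zero {w : ℍ → ℝ} {x : ℍ} (hx : x ∉ tsupport w) : quatGrad w x = 0 := by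
  have h0 : fderiv ℝ w x = 0 :=
    image_eq_zero_of_notMem_tsupport fun hx' => hx (tsupport_fderiv_subset ℝ hx')
  simp [quatGrad, h0]

theorem fluxDiv_eq_zero {w : ℍ → ℝ} (A B : ℍ → ℍ) {x : ℍ} (hx : x ∉ tsupport w) :
    fluxDiv w A B x = 0 := by
  simp [fluxDiv, quatGrad_eq_zero hx, image_eq_zero_of_notMem_tsupport hx]

theorem continuous_fluxDiv {w : ℍ → ℝ} (hw : ContDiff ℝ 1 w) {A B : ℍ → ℍ} (hA : Continuous A)
    (hB : Continuous B) : Continuous (fluxDiv w A B) := by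
  have h1 : Continuous fun x => ((2 * ‖B x‖ ^ 2 : ℝ) : ℍ) :=
    Quaternion.continuous_coe.comp (by fun_prop)
  exact (hw.continuous.smul h1).add ((hA.star.mul (continuous_quatGrad hw)).mul hB)

theorem hasCompactSupport_fluxDiv {w : ℍ → ℝ} (hc : HasCompactSupport w) (A B : ℍ → ℍ) :
    HasCompactSupport (fluxDiv w A B) :=
  HasCompactSupport.intro hc fun _ hx => fluxDiv_eq_zero A B hx

theorem norm_fluxDiv_le {w : ℍ → ℝ} {A B : ℍ → ℍ} {x : ℍ} {α β : ℝ} (hA : ‖A x‖ ≤ α)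
    (hB : ‖B x‖ ≤ β) :
    ‖fluxDiv w A B x‖ ≤ |w x| * (2 * β ^ 2) + α * ‖quatGrad w x‖ * β := by
  have hα := (norm_nonneg _).trans hA
  have hβ := (norm_nonneg _).trans hB
  refine (norm_add_le _ _).trans (add_le_add ?_ ?_)
  · rw [norm_smul, Quaternion.norm_coe, Real.norm_of_nonneg (by positivity : 0 ≤ 2 * ‖B x‖ ^ 2),
      Real.norm_eq_abs]
    gcongr
  · rw [norm_mul, norm_mul, norm_star]
    gcongr

/-- The divergence theorem below a Lipschitz graph for the field `v ↦ w ḡ v D̄g`, `g` smooth. -/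
theorem integral_fluxDiv_subgraph_of_smooth {C : ℝ≥0} (hh : LipschitzWith C h) {w : ℍ → ℝ}
    (hw : ContDiff ℝ 1 w) (hc : HasCompactSupport w) {g : ℍ → ℍ} (hg : ContDiff ℝ ∞ g) {b : ℝ}
    (hreg : ∀ p : ℝ × (Fin 3 → ℝ), p.1 ≤ b → graphMap R h p ∈ tsupport w →
      ∀ᶠ z in 𝓝 (graphMap R h p), fueterD g z = 0) :
    ∫ p in Iic b ×ˢ univ, fluxDiv w g (fueterDbar g) (graphMap R h p)
      = ∫ y, w (graphMap R h (b, y)) • (star (g (graphMap R h (b, y))) * graphNormal R h y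
          * fueterDbar g (graphMap R h (b, y))) := by
  let W : Fin 4 → ℍ → ℍ := fun k z => w z • (star (g z) * R (qunit k) * fueterDbar g z)
  have hg1 : ContDiff ℝ 1 g := hg.of_le (by exact_mod_cast le_top)
  have hB1 : ContDiff ℝ 1 (fueterDbar g) :=
    (contDiff_fueterDbar hg).of_le (by exact_mod_cast le_top)
  have hstar : ContDiff ℝ 1 (fun z => star (g z)) := (starL' ℝ (A := ℍ)).contDiff.comp hg1
  have hW : ∀ k, ContDiff ℝ 1 (W k) := fun k =>
    hw.smul ((hstar.mul contDiff_const).mul hB1)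
  have hWc : ∀ k, HasCompactSupport (W k) := fun k => hc.smul_right
  have hdiv := integral_div_subgraph (R := R) hh hW hWc b
  have hL : ∫ p in Iic b ×ˢ univ, ∑ k, fderiv ℝ (W k) (graphMap R h p) (R (qunit k))
      = ∫ p in Iic b ×ˢ univ, fluxDiv w g (fueterDbar g) (graphMap R h p) := by
    refine setIntegral_congr_fun (measurableSet_Iic.prod MeasurableSet.univ) fun p hp => ?_
    -- Regularity of `g` is available only near the support of `w`; off the support both integrands
    -- vanish.
    by_cases hx : graphMap R h p ∈ tsupport w
    · exact sum_fderiv_flux R hw hg (hreg p hp.1 hx)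
    · rw [fluxDiv_eq_zero _ _ hx]
      refine Finset.sum_eq_zero fun k _ => ?_
      have h0 : fderiv ℝ (W k) (graphMap R h p) = 0 := by
        refine image_eq_zero_of_notMem_tsupport fun hx' => hx ?_
        exact tsupport_smul_subset_left w _ (tsupport_fderiv_subset ℝ hx')
      rw [h0]; rfl
  rw [← hL, hdiv]
  refine integral_congr_ae (Eventually.of_forall fun y => ?_)
  simp only [W, graphNormal_eq, mul_sub, sub_mul, Finset.mul_sum, Finset.sum_mul, smul_sub,
    Finset.smul_sum, mul_smul_comm, smul_mul_assoc]
  congr 1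
  exact Finset.sum_congr rfl fun a _ => smul_comm _ _ _

theorem norm_dbarOp_le (L : ℍ →L[ℝ] ℍ) : ‖dbarOp L‖ ≤ 2 * ‖L‖ := by
  have hq : ∀ k, ‖qunit k‖ = 1 := fun k => by
    rw [← quatBasis_apply]; exact quatBasis.norm_eq_one k
  have hk : ∀ k ∈ Finset.univ, ‖star (qunit k) * L (qunit k)‖ ≤ ‖L‖ := fun k _ => by
    rw [norm_mul, norm_star, hq, one_mul]
    simpa [hq] using L.le_opNorm (qunit k)
  rw [dbarOp_apply, norm_smul]
  have h1 := norm_sum_le_of_le _ hk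
  simp only [Finset.sum_const, Finset.card_univ, Fintype.card_fin, nsmul_eq_mul] at h1
  norm_num at h1 ⊢
  linarith

theorem exists_regular_approx {Ω K : Set ℍ} (hΩ : IsOpen Ω) (hK : IsCompact K) (hKΩ : K ⊆ Ω)
    {A : ℍ → ℍ} (hA : IsLeftRegular Ω A) {ε : ℝ} (hε : 0 < ε) :
    ∃ g : ℍ → ℍ, ContDiff ℝ ∞ g ∧
      (∀ x ∈ K, ‖g x - A x‖ ≤ ε ∧ ‖fueterDbar g x - fueterDbar A x‖ ≤ ε) ∧
      ∀ x ∈ K, ∀ᶠ z in 𝓝 x, fueterD g z = 0 := by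
  -- Precision `ε / 2` because `D̄` at most doubles the norm of the derivative.
  obtain ⟨g, hg, hgA, hgD⟩ := exists_contDiff_approx_of_fderiv_constraint hΩ hK hKΩ hA.1 dOp
    (fun x hx => (fueterD_eq_dOp A x).symm.trans (hA.2 x hx)) (half_pos hε)
  refine ⟨g, hg, fun x hx => ⟨(hgA x hx).1.trans (by linarith), ?_⟩, fun x hx => ?_⟩
  · rw [fueterDbar_eq_dbarOp, fueterDbar_eq_dbarOp, ← map_sub]
    linarith [norm_dbarOp_le (fderiv ℝ g x - fderiv ℝ A x), (hgA x hx).2]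
  · filter_upwards [hgD x hx] with z hz
    rw [fueterD_eq_dOp, hz]

/-- The divergence theorem below a Lipschitz graph for the field `v ↦ w Ā v D̄A`, where `A` is
left-regular near the relevant part of the closed subgraph. -/
theorem integral_fluxDiv_subgraph_of_regular {C : ℝ≥0} (hh : LipschitzWith C h) {w : ℍ → ℝ}
    (hw : ContDiff ℝ 1 w) (hc : HasCompactSupport w) {Ω : Set ℍ} (hΩ : IsOpen Ω) {A B : ℍ → ℍ}
    (hAc : Continuous A) (hBc : Continuous B) (hA : IsLeftRegular Ω A)
    (hAB : EqOn B (fueterDbar A) Ω) {b : ℝ}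
    (hsub : ∀ p : ℝ × (Fin 3 → ℝ), p.1 ≤ b → graphMap R h p ∈ tsupport w → graphMap R h p ∈ Ω) :
    ∫ p in Iic b ×ˢ univ, fluxDiv w A B (graphMap R h p)
      = ∫ y, w (graphMap R h (b, y)) • (star (A (graphMap R h (b, y))) * graphNormal R h y
          * B (graphMap R h (b, y))) := by
  have hT := continuous_graphMap (R := R) hh.continuous
  have hTb : Continuous fun y => graphMap R h (b, y) := hT.comp (by fun_prop)
  -- The part of the closed subgraph that `w` sees: compact and inside `Ω`, so the approximation is
  -- uniform on it.
  let K := tsupport w ∩ {x | ((rotEquiv R).symm x).1 ≤ h ((rotEquiv R).symm x).2 + b}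
  have hKmem : ∀ p : ℝ × (Fin 3 → ℝ), p.1 ≤ b → graphMap R h p ∈ tsupport w →
      graphMap R h p ∈ K := fun p hp hx => ⟨hx, by simpa [graphMap, -rotEquiv_apply] using hp⟩
  have hK : IsCompact K := by
    have hs := (rotEquiv R).symm.continuous
    have hhc := hh.continuous
    exact hc.isCompact.inter_right (isClosed_le (by fun_prop) (by fun_prop))
  have hKΩ : K ⊆ Ω := fun x hx => by
    obtain ⟨p, rfl⟩ := graphMap_surjective (R := R) (h := h) x
    exact hsub p (by simpa [graphMap, -rotEquiv_apply] using hx.2) hx.1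
  choose g hg hgA hgD using fun n : ℕ =>
    exists_regular_approx hΩ hK hKΩ hA (Nat.one_div_pos_of_nat (α := ℝ) (n := n))
  have hle1 : ∀ n : ℕ, 1 / ((n : ℝ) + 1) ≤ 1 := fun n => by
    rw [div_le_one (by positivity)]; linarith [(Nat.cast_nonneg n : (0 : ℝ) ≤ n)]
  have hgA' : ∀ n, ∀ x ∈ K, ‖g n x‖ ≤ ‖A x‖ + 1 := fun n x hx => by
    have h1 := (hgA n x hx).1.trans (hle1 n)
    have h2 := norm_le_norm_add_norm_sub' (g n x) (A x)
    linarith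
  have hgB' : ∀ n, ∀ x ∈ K, ‖fueterDbar (g n) x‖ ≤ ‖B x‖ + 1 := fun n x hx => by
    have h1 := (hgA n x hx).2.trans (hle1 n)
    rw [← hAB (hKΩ hx)] at h1
    have h2 := norm_le_norm_add_norm_sub' (fueterDbar (g n) x) (B x)
    linarith
  have hlimA : ∀ x ∈ K, Tendsto (fun n => g n x) atTop (𝓝 (A x)) := fun x hx => by
    rw [tendsto_iff_norm_sub_tendsto_zero]
    exact squeeze_zero (fun n => norm_nonneg _) (fun n => (hgA n x hx).1)
      tendsto_one_div_add_atTop_nhds_zero_nat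
  have hlimB : ∀ x ∈ K, Tendsto (fun n => fueterDbar (g n) x) atTop (𝓝 (B x)) := fun x hx => by
    rw [tendsto_iff_norm_sub_tendsto_zero]
    refine squeeze_zero (fun n => norm_nonneg _) (fun n => ?_)
      tendsto_one_div_add_atTop_nhds_zero_nat
    rw [hAB (hKΩ hx)]
    exact (hgA n x hx).2
  have hBn : ∀ n, Continuous (fueterDbar (g n)) := fun n => (contDiff_fueterDbar (hg n)).continuous
  have hAn : ∀ n, Continuous (g n) := fun n => (hg n).continuous
  obtain ⟨M, hM⟩ := exists_norm_graphNormal_le (R := R) hh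
  have hmeas : MeasurableSet (Iic b ×ˢ (univ : Set (Fin 3 → ℝ))) :=
    measurableSet_Iic.prod MeasurableSet.univ
  have key := fun n => integral_fluxDiv_subgraph_of_smooth (R := R) (b := b) hh hw hc (hg n)
    fun p hp hx => hgD n _ (hKmem p hp hx)
  have hwb : Continuous fun y => w (graphMap R h (b, y)) := hw.continuous.comp hTb
  have hwbc : HasCompactSupport fun y => w (graphMap R h (b, y)) :=
    hasCompactSupport_comp_graph (hc.comp_homeomorph (rotEquiv R).toHomeomorph) h b
  have lim1 : Tendsto (fun n => ∫ p in Iic b ×ˢ univ,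
      fluxDiv w (g n) (fueterDbar (g n)) (graphMap R h p)) atTop
      (𝓝 (∫ p in Iic b ×ˢ univ, fluxDiv w A B (graphMap R h p))) := by
    -- All approximants are within `1 / (n + 1) ≤ 1` of their limits on `K`, hence the `+ 1` in a
    -- bound independent of `n`.
    let bd : ℍ → ℝ := fun x =>
      |w x| * (2 * (‖B x‖ + 1) ^ 2) + (‖A x‖ + 1) * ‖quatGrad w x‖ * (‖B x‖ + 1)
    have hqc := continuous_quatGrad hw
    have hwc := hw.continuous
    have hbdc : Continuous bd := by fun_prop
    have hbdcs : HasCompactSupport bd := HasCompactSupport.intro hc fun x hx => by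
      simp [bd, image_eq_zero_of_notMem_tsupport hx, quatGrad_eq_zero hx]
    refine tendsto_integral_of_dominated_convergence (fun p => bd (graphMap R h p)) (fun n => ?_)
      (Continuous.integrable_of_hasCompactSupport (hbdc.comp hT)
        (hasCompactSupport_comp_graphMap hh.continuous hbdcs)).integrableOn (fun n => ?_) ?_
    · exact ((continuous_fluxDiv hw (hAn n) (hBn n)).comp hT).aestronglyMeasurable
    · filter_upwards [ae_restrict_mem hmeas] with p hp
      by_cases hx : graphMap R h p ∈ tsupport w
      · have hxK := hKmem p hp.1 hx
        exact norm_fluxDiv_le (hgA' n _ hxK) (hgB' n _ hxK)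
      · rw [fluxDiv_eq_zero _ _ hx, norm_zero]
        positivity
    · filter_upwards [ae_restrict_mem hmeas] with p hp
      by_cases hx : graphMap R h p ∈ tsupport w
      · have hxK := hKmem p hp.1 hx
        have h2 : Tendsto (fun n => ((2 * ‖fueterDbar (g n) (graphMap R h p)‖ ^ 2 : ℝ) : ℍ)) atTop
            (𝓝 ((2 * ‖B (graphMap R h p)‖ ^ 2 : ℝ) : ℍ)) :=
          (Quaternion.continuous_coe.tendsto _).comp (((hlimB _ hxK).norm.pow 2).const_mul 2)
        exact (h2.const_smul _).add (((hlimA _ hxK).star.mul_const _).mul (hlimB _ hxK))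
      · simp only [fluxDiv_eq_zero _ _ hx]
        exact tendsto_const_nhds
  have lim2 : Tendsto (fun n => ∫ y, w (graphMap R h (b, y)) • (star (g n (graphMap R h (b, y)))
      * graphNormal R h y * fueterDbar (g n) (graphMap R h (b, y)))) atTop
      (𝓝 (∫ y, w (graphMap R h (b, y)) • (star (A (graphMap R h (b, y))) * graphNormal R h y
          * B (graphMap R h (b, y))))) := by
    refine tendsto_integral_of_dominated_convergence (fun y => |w (graphMap R h (b, y))| *
      ((‖A (graphMap R h (b, y))‖ + 1) * M * (‖B (graphMap R h (b, y))‖ + 1)))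
      (fun n => (integrable_flux hh hwb hwbc ((hAn n).comp hTb)
        ((hBn n).comp hTb)).aestronglyMeasurable) ?_ (fun n => ?_) ?_
    · exact Continuous.integrable_of_hasCompactSupport (by fun_prop)
        ((hwbc.comp_left (g := fun t : ℝ => |t|) abs_zero).mul_right)
    · refine Eventually.of_forall fun y => ?_
      by_cases hx : graphMap R h (b, y) ∈ tsupport w
      · have hxK := hKmem (b, y) le_rfl hx
        have hM0 := (norm_nonneg _).trans (hM y)
        rw [norm_smul, norm_mul, norm_mul, norm_star, Real.norm_eq_abs]
        gcongr
        exacts [hgA' n _ hxK, hM y, hgB' n _ hxK]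
      · simp [image_eq_zero_of_notMem_tsupport hx]
    · refine Eventually.of_forall fun y => ?_
      by_cases hx : graphMap R h (b, y) ∈ tsupport w
      · have hxK := hKmem (b, y) le_rfl hx
        exact (((hlimA _ hxK).star.mul_const _).mul (hlimB _ hxK)).const_smul _
      · simp only [image_eq_zero_of_notMem_tsupport hx, zero_smul]
        exact tendsto_const_nhds
  exact tendsto_nhds_unique lim1 (by simpa only [key] using lim2)

end Flux

/-! ### From shifted graphs to the boundary itself, in one chart. -/

section Charts

variable {Ω : Set ℍ}

theorem BoundaryChart.param_eq_graphMap (c : BoundaryChart Ω) (y : Fin 3 → ℝ) :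
    c.param y = graphMap c.rot c.height (0, y) := by
  simp [BoundaryChart.param, graphMap]

theorem BoundaryChart.graphMap_mem_iff (c : BoundaryChart Ω) {p : ℝ × (Fin 3 → ℝ)}
    (hp : graphMap c.rot c.height p ∈ c.nbhd) : graphMap c.rot c.height p ∈ Ω ↔ p.1 < 0 := by
  rw [graphMap, rotEquiv_apply] at hp ⊢
  rw [c.mem_iff _ _ hp]
  exact add_lt_iff_neg_left

/-- A graph point inside the neighbourhood is not in `Ω`, but the points just below it are. -/
theorem BoundaryChart.param_mem_frontier (c : BoundaryChart Ω) {y : Fin 3 → ℝ}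
    (hy : c.param y ∈ c.nbhd) : c.param y ∈ frontier Ω := by
  obtain ⟨C, hC⟩ := c.lipschitz_height
  rw [c.param_eq_graphMap] at hy ⊢
  have hnot : graphMap c.rot c.height (0, y) ∉ Ω := fun hmem =>
    lt_irrefl _ ((c.graphMap_mem_iff hy).1 hmem)
  refine ⟨?_, fun hi => hnot (interior_subset hi)⟩
  have hcont : Continuous fun t : ℝ => graphMap c.rot c.height (t, y) :=
    (continuous_graphMap hC.continuous).comp (by fun_prop)
  have hlim : Tendsto (fun t : ℝ => graphMap c.rot c.height (t, y)) (𝓝[<] 0)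
      (𝓝 (graphMap c.rot c.height (0, y))) := (hcont.tendsto 0).mono_left nhdsWithin_le_nhds
  refine mem_closure_of_tendsto hlim ?_
  filter_upwards [hlim.eventually (c.isOpen_nbhd.mem_nhds hy), self_mem_nhdsWithin] with t ht ht0
  exact (c.graphMap_mem_iff ht).2 ht0

/-- Near an interior point, `Ω` is bounded by no graph at all: a horizontal plane above the
point, outside the neighbourhood, serves as one. -/
theorem exists_boundaryChart_of_mem (hΩ : IsOpen Ω) {q : ℍ} (hq : q ∈ Ω) :
    ∃ c : BoundaryChart Ω, q ∈ c.nbhd :=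
  ⟨{ rot := LinearIsometryEquiv.refl ℝ ℍ
     det_rot := LinearMap.det_id
     height := fun _ => q.re + 1
     lipschitz_height := ⟨0, LipschitzWith.const _⟩
     nbhd := Ω ∩ {x | x.re < q.re + 1}
     isOpen_nbhd := hΩ.inter (isOpen_lt Quaternion.continuous_re continuous_const)
     mem_iff := fun _ _ h => ⟨fun _ => h.2, fun _ => h.1⟩ }, hq, lt_add_one q.re⟩

theorem exists_boundaryChart_of_mem_closure (hΩ : IsLipschitzDomain Ω) {q : ℍ}
    (hq : q ∈ closure Ω) : ∃ c : BoundaryChart Ω, q ∈ c.nbhd := by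
  by_cases h : q ∈ Ω
  · exact exists_boundaryChart_of_mem hΩ.isOpen h
  · exact hΩ.exists_chart q ⟨hq, fun hi => h (interior_subset hi)⟩

open scoped Manifold in
/-- A smooth partition of unity on a compact set, subordinate to boundary charts. -/
theorem exists_partition_of_charts {S : Set ℍ} (hS : IsCompact S)
    (hcov : ∀ q ∈ S, ∃ c : BoundaryChart Ω, q ∈ c.nbhd) :
    ∃ (n : ℕ) (c : Fin n → BoundaryChart Ω) (θ : Fin n → ℍ → ℝ),
      (∀ i, ContDiff ℝ ∞ (θ i)) ∧ (∀ i q, 0 ≤ θ i q) ∧ (∀ i, HasCompactSupport (θ i)) ∧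
      (∀ i, tsupport (θ i) ⊆ (c i).nbhd) ∧ ∀ q ∈ S, ∑ i, θ i q = 1 := by
  choose c hc using hcov
  obtain ⟨t, hSt⟩ := hS.elim_nhds_subcover' (fun q hq => (c q hq).nbhd)
    fun q hq => (c q hq).isOpen_nbhd.mem_nhds (hc q hq)
  obtain ⟨r, hr⟩ := hS.isBounded.subset_ball (0 : ℍ)
  let e := t.equivFin
  let U : Fin t.card → Set ℍ := fun i => (c (e.symm i).1 (e.symm i).1.2).nbhd ∩ Metric.ball 0 r
  obtain ⟨f, hf⟩ := SmoothPartitionOfUnity.exists_isSubordinate 𝓘(ℝ, ℍ) hS.isClosed U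
    (fun i => (c _ _).isOpen_nbhd.inter Metric.isOpen_ball) (fun q hq => by
      obtain ⟨x, hx, hqx⟩ := mem_iUnion₂.1 (hSt hq)
      refine mem_iUnion.2 ⟨e ⟨x, hx⟩, ?_, hr hq⟩
      simpa using hqx)
  refine ⟨t.card, fun i => c (e.symm i).1 (e.symm i).1.2, fun i => f i,
    fun i => contMDiff_iff_contDiff.1 (f i).contMDiff, fun i q => f.nonneg i q, fun i => ?_,
    fun i => (hf i).trans inter_subset_left, fun q hq => ?_⟩
  · exact (isCompact_closedBall (0 : ℍ) r).of_isClosed_subset (isClosed_tsupport _)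
      ((hf i).trans (inter_subset_right.trans Metric.ball_subset_closedBall))
  · rw [← f.sum_eq_one hq, finsum_eq_sum_of_fintype]

/-- The divergence theorem in a chart for the field `v ↦ w Ā v D̄A`, with `A` left-regular. -/
theorem BoundaryChart.integral_fluxDiv (c : BoundaryChart Ω) (hΩ : IsOpen Ω) {A B : ℍ → ℍ}
    (hAc : Continuous A) (hBc : Continuous B) (hA : IsLeftRegular Ω A)
    (hAB : EqOn B (fueterDbar A) Ω) {w : ℍ → ℝ} (hw : ContDiff ℝ 1 w) (hc : HasCompactSupport w)
    (hsub : tsupport w ⊆ c.nbhd) :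
    ∫ x in Ω, fluxDiv w A B x = ∫ y, w (c.param y) •
      (star (A (c.param y)) * graphNormal c.rot c.height y * B (c.param y)) := by
  obtain ⟨C, hh⟩ := c.lipschitz_height
  have hT := continuous_graphMap (R := c.rot) hh.continuous
  -- Strictly negative shifts keep the subgraph, within the support of `w`, inside the open set `Ω`
  -- where `A` is regular.
  let b : ℕ → ℝ := fun n => -(1 / ((n : ℝ) + 1))
  have hb : ∀ n, b n < 0 := fun n => neg_neg_of_pos Nat.one_div_pos_of_nat
  have hblim : Tendsto b atTop (𝓝 0) := by
    have h := (tendsto_one_div_add_atTop_nhds_zero_nat (𝕜 := ℝ)).neg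
    rwa [neg_zero] at h
  have key := fun n => integral_fluxDiv_subgraph_of_regular (R := c.rot) (b := b n) hh hw hc hΩ hAc
    hBc hA hAB fun p hp hx => (c.graphMap_mem_iff (hsub hx)).2 (hp.trans_lt (hb n))
  have hmeas : ∀ n, MeasurableSet (Iic (b n) ×ˢ (univ : Set (Fin 3 → ℝ))) := fun n =>
    measurableSet_Iic.prod MeasurableSet.univ
  have hΘ : Integrable fun p => fluxDiv w A B (graphMap c.rot c.height p) :=
    Continuous.integrable_of_hasCompactSupport ((continuous_fluxDiv hw hAc hBc).comp hT)
      (hasCompactSupport_comp_graphMap hh.continuous (hasCompactSupport_fluxDiv hc A B))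
  have lim1 : Tendsto (fun n => ∫ p in Iic (b n) ×ˢ univ,
      fluxDiv w A B (graphMap c.rot c.height p)) atTop (𝓝 (∫ x in Ω, fluxDiv w A B x)) := by
    rw [← integral_indicator hΩ.measurableSet, ← integral_comp_graphMap (R := c.rot) hh.continuous]
    simp only [← integral_indicator (hmeas _)]
    refine tendsto_integral_of_dominated_convergence _
      (fun n => (hΘ.indicator (hmeas n)).aestronglyMeasurable) hΘ.norm
      (fun n => Eventually.of_forall fun p => norm_indicator_le_norm_self _ _)
      (Eventually.of_forall fun p => ?_)
    -- On the support of `w`, `Ω` is `p.1 < 0`, and the indicators of `p.1 ≤ b n` converge to its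
    -- indicator at every point, the graph `p.1 = 0` included.
    by_cases hx : graphMap c.rot c.height p ∈ tsupport w
    · have hiff := c.graphMap_mem_iff (hsub hx)
      by_cases hp : p.1 < 0
      · rw [indicator_of_mem (hiff.2 hp)]
        refine tendsto_const_nhds.congr' ?_
        filter_upwards [hblim.eventually (lt_mem_nhds hp)] with n hn
        rw [indicator_of_mem (show p ∈ Iic (b n) ×ˢ univ from ⟨hn.le, mem_univ _⟩)]
      · rw [indicator_of_notMem fun h => hp (hiff.1 h)]
        refine tendsto_const_nhds.congr fun n => ?_
        rw [indicator_of_notMem fun h => hp (lt_of_le_of_lt h.1 (hb n))]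
    · have h0 := fluxDiv_eq_zero A B hx
      have h1 : Ω.indicator (fluxDiv w A B) (graphMap c.rot c.height p) = 0 :=
        indicator_apply_eq_zero.2 fun _ => h0
      rw [h1]
      simp only [indicator_apply, h0, ite_self]
      exact tendsto_const_nhds
  have lim2 : Tendsto (fun n => ∫ y, w (graphMap c.rot c.height (b n, y)) •
      (star (A (graphMap c.rot c.height (b n, y))) * graphNormal c.rot c.height y
        * B (graphMap c.rot c.height (b n, y)))) atTop
      (𝓝 (∫ y, w (c.param y) •
        (star (A (c.param y)) * graphNormal c.rot c.height y * B (c.param y)))) := by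
    obtain ⟨M, hM⟩ := exists_norm_graphNormal_le (R := c.rot) hh
    let q : ℍ → ℝ := fun x => |w x| * (‖A x‖ * ‖B x‖)
    have hwc := hw.continuous
    have hq : Continuous q := by fun_prop
    have hqc : HasCompactSupport q := HasCompactSupport.mul_right
      (hc.comp_left (g := fun t : ℝ => |t|) abs_zero)
    obtain ⟨Q, hQ⟩ := hqc.exists_bound_of_continuous hq
    -- The shadow of the support of `w`: it contains every `y` at which some shifted graph meets the
    -- support, so the dominating function does not depend on `n`.
    let Y : Set (Fin 3 → ℝ) := (fun x => ((rotEquiv c.rot).symm x).2) '' tsupport w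
    have hY : IsCompact Y := hc.isCompact.image
      (continuous_snd.comp (rotEquiv c.rot).symm.continuous)
    have hTn : ∀ t, Continuous fun y => graphMap c.rot c.height (t, y) := fun t =>
      hT.comp (by fun_prop)
    refine tendsto_integral_of_dominated_convergence (Y.indicator fun _ => Q * M)
      (fun n => ?_) ?_ (fun n => Eventually.of_forall fun y => ?_)
      (Eventually.of_forall fun y => ?_)
    · exact (integrable_flux hh (hwc.comp (hTn _))
        (hasCompactSupport_comp_graph (hc.comp_homeomorph (rotEquiv c.rot).toHomeomorph) _ _)
        (hAc.comp (hTn _)) (hBc.comp (hTn _))).aestronglyMeasurable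
    · exact (integrable_indicator_iff hY.measurableSet).2
        (integrableOn_const hY.measure_lt_top.ne)
    · by_cases hx : graphMap c.rot c.height (b n, y) ∈ tsupport w
      · rw [indicator_of_mem (show y ∈ Y from ⟨_, hx, by
          simp [graphMap, -rotEquiv_apply]⟩)]
        have h1 := hQ (graphMap c.rot c.height (b n, y))
        rw [Real.norm_of_nonneg (by positivity)] at h1
        rw [norm_smul, norm_mul, norm_mul, norm_star, Real.norm_eq_abs]
        calc _ = q (graphMap c.rot c.height (b n, y)) * ‖graphNormal c.rot c.height y‖ := by
              simp only [q]; ring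
          _ ≤ Q * M := mul_le_mul h1 (hM y) (norm_nonneg _) ((by positivity : 0 ≤ q _).trans h1)
      · rw [image_eq_zero_of_notMem_tsupport hx, zero_smul, norm_zero]
        exact indicator_nonneg (fun _ _ => mul_nonneg ((norm_nonneg _).trans (hQ 0))
          ((norm_nonneg _).trans (hM 0))) y
    · rw [c.param_eq_graphMap]
      have hlim : Tendsto (fun n => graphMap c.rot c.height (b n, y)) atTop
          (𝓝 (graphMap c.rot c.height (0, y))) :=
        (hT.tendsto _).comp (hblim.prodMk_nhds tendsto_const_nhds)
      exact ((hwc.tendsto _).comp hlim).smul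
        (((((hAc.tendsto _).comp hlim).star).mul_const _).mul ((hBc.tendsto _).comp hlim))
  exact tendsto_nhds_unique lim1 (by simpa only [key] using lim2)

end Charts

/-! ### Gluing the charts, and identification with the boundary integral. -/

section Global

variable {Ω : Set ℍ} {A B : ℍ → ℍ}

theorem fluxDiv_congr {w w' : ℍ → ℝ} {x : ℍ} (h : w =ᶠ[𝓝 x] w') :
    fluxDiv w A B x = fluxDiv w' A B x := by
  rw [fluxDiv, fluxDiv, quatGrad, quatGrad, h.fderiv_eq, h.eq_of_nhds]

theorem fluxDiv_sum {ι : Type*} [Fintype ι] {w : ι → ℍ → ℝ} {x : ℍ}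
    (hw : ∀ i, DifferentiableAt ℝ (w i) x) :
    fluxDiv (fun z => ∑ i, w i z) A B x = ∑ i, fluxDiv (w i) A B x := by
  have hq : quatGrad (fun z => ∑ i, w i z) x = ∑ i, quatGrad (w i) x := by
    simp only [quatGrad]
    rw [fderiv_fun_sum fun i _ => hw i, Finset.sum_comm]
    simp [Finset.sum_smul]
  simp only [fluxDiv, hq, Finset.sum_add_distrib, Finset.sum_smul, Finset.mul_sum, Finset.sum_mul]

theorem fluxDiv_one_sub (w : ℍ → ℝ) (x : ℍ) :
    fluxDiv (fun z => 1 - w z) A B x = ((2 * ‖B x‖ ^ 2 : ℝ) : ℍ) - fluxDiv w A B x := by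
  have hq : quatGrad (fun z => 1 - w z) x = -quatGrad w x := by
    simp [quatGrad, fderiv_const_sub]
  simp only [fluxDiv, hq, sub_smul, one_smul, mul_neg, neg_mul]
  abel

theorem integrableOn_of_continuous {M : Type*} [NormedAddCommGroup M]
    (hΩ : Bornology.IsBounded Ω) {f : ℍ → M} (hf : Continuous f) : IntegrableOn f Ω :=
  (hf.continuousOn.integrableOn_compact hΩ.isCompact_closure).mono_set subset_closure

/-- A weight that vanishes on the boundary has no flux. -/
theorem integral_fluxDiv_eq_zero (hΩ : IsLipschitzDomain Ω) (hAc : Continuous A)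
    (hBc : Continuous B) (hA : IsLeftRegular Ω A) (hAB : EqOn B (fueterDbar A) Ω) {w : ℍ → ℝ}
    (hw : ContDiff ℝ 1 w) (h0 : ∀ q ∈ frontier Ω, w q = 0) : ∫ x in Ω, fluxDiv w A B x = 0 := by
  -- The partition covers the whole closure, interior points included, so that the pieces `θ i * w`
  -- add up to `w` on `Ω`.
  obtain ⟨n, c, θ, hθ, -, hθc, hθs, hθ1⟩ := exists_partition_of_charts
    hΩ.isBounded.isCompact_closure fun q hq => exists_boundaryChart_of_mem_closure hΩ hq
  have hθw : ∀ i, ContDiff ℝ 1 fun x => θ i x * w x := fun i =>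
    ((hθ i).of_le (by exact_mod_cast le_top)).mul hw
  have hsum : EqOn (fluxDiv w A B) (fun x => ∑ i, fluxDiv (fun z => θ i z * w z) A B x) Ω :=
    fun x hx => by
      simp only
      rw [← fluxDiv_sum fun i => (hθw i).differentiable (by norm_num) x]
      refine fluxDiv_congr ?_
      filter_upwards [hΩ.isOpen.mem_nhds hx] with z hz
      rw [← Finset.sum_mul, hθ1 z (subset_closure hz), one_mul]
  rw [setIntegral_congr_fun hΩ.isOpen.measurableSet hsum, integral_finsetSum _ fun i _ =>
    integrableOn_of_continuous hΩ.isBounded (continuous_fluxDiv (hθw i) hAc hBc)]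
  refine Finset.sum_eq_zero fun i _ => ?_
  have hsub : tsupport (fun x => θ i x * w x) ⊆ (c i).nbhd :=
    (tsupport_mul_subset_left (f := θ i)).trans (hθs i)
  rw [(c i).integral_fluxDiv hΩ.isOpen hAc hBc hA hAB (hθw i) (hθc i).mul_right hsub]
  refine integral_eq_zero_of_ae (Eventually.of_forall fun y => ?_)
  -- Inside the chart neighbourhood the point lies on the boundary, where `w` vanishes; outside it
  -- `θ i` does.
  have hz : θ i ((c i).param y) * w ((c i).param y) = 0 := by
    by_cases hy : (c i).param y ∈ (c i).nbhd
    · rw [h0 _ ((c i).param_mem_frontier hy), mul_zero]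
    · rw [image_eq_zero_of_notMem_tsupport fun h => hy (hθs i h), zero_mul]
  simp only [hz, zero_smul, Pi.zero_apply]

/-- The weight `1 - ∑ w i` vanishes on the boundary, so its `fluxDiv` has integral zero; by
linearity that `fluxDiv` is `2 ‖B‖²` minus the sum of the others. -/
theorem sum_integral_fluxDiv (hΩ : IsLipschitzDomain Ω) (hAc : Continuous A)
    (hBc : Continuous B) (hA : IsLeftRegular Ω A) (hAB : EqOn B (fueterDbar A) Ω) {n : ℕ}
    {w : Fin n → ℍ → ℝ} (hw : ∀ i, ContDiff ℝ 1 (w i)) (h1 : ∀ q ∈ frontier Ω, ∑ i, w i q = 1) :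
    ∑ i, ∫ x in Ω, fluxDiv (w i) A B x = ((2 * ∫ x in Ω, ‖B x‖ ^ 2 : ℝ) : ℍ) := by
  have hsum : ContDiff ℝ 1 fun x => ∑ i, w i x := ContDiff.sum fun i _ => hw i
  have h := integral_fluxDiv_eq_zero hΩ hAc hBc hA hAB (contDiff_const.sub hsum)
    (fun q hq => by rw [h1 q hq, sub_self] : ∀ q ∈ frontier Ω, (1 : ℝ) - ∑ i, w i q = 0)
  have hd : ∀ x, fluxDiv (fun z => (1 : ℝ) - ∑ i, w i z) A B x
      = (2 * ‖B x‖ ^ 2) • (1 : ℍ) - ∑ i, fluxDiv (w i) A B x := fun x => by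
    rw [fluxDiv_one_sub, fluxDiv_sum fun i => (hw i).differentiable (by norm_num) x,
      ← Algebra.algebraMap_eq_smul_one]
    rfl
  have hi : ∀ i, IntegrableOn (fun x => fluxDiv (w i) A B x) Ω := fun i =>
    integrableOn_of_continuous hΩ.isBounded (continuous_fluxDiv (hw i) hAc hBc)
  simp only [hd] at h
  rw [integral_sub (integrableOn_of_continuous hΩ.isBounded (by fun_prop))
    (integrable_finsetSum _ fun i _ => hi i), integral_finsetSum _ fun i _ => hi i, sub_eq_zero,
    integral_smul_const, integral_const_mul, ← Algebra.algebraMap_eq_smul_one] at h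
  exact h.symm

/-- Wherever the height is differentiable, almost everywhere by Rademacher, `dsigma` of the tangent
vectors is the rotated graph normal. -/
theorem BoundaryChart.pullback_stokesForm_ae (c : BoundaryChart Ω) (F : ℍ → ℍ) :
    ∀ᵐ y, c.pullback (stokesForm Ω F) y = star (F (c.param y)) *
      (graphNormal c.rot c.height y * extendFrom Ω (fueterDbar F) (c.param y)) := by
  obtain ⟨C, hh⟩ := c.lipschitz_height
  filter_upwards [hh.ae_differentiableAt (μ := volume)] with y hy
  have hder : HasFDerivAt c.param (((rotEquiv c.rot : (ℝ × (Fin 3 → ℝ)) ≃L[ℝ] ℍ) :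
      (ℝ × (Fin 3 → ℝ)) →L[ℝ] ℍ).comp
        ((fderiv ℝ c.height y).prod (ContinuousLinearMap.id ℝ (Fin 3 → ℝ)))) y :=
    (rotEquiv c.rot).hasFDerivAt.comp y (hy.hasFDerivAt.prodMk (hasFDerivAt_id y))
  have htan : (fun a => fderiv ℝ c.param y (Pi.single a 1)) = fun a : Fin 3 =>
      c.rot (point (fderiv ℝ c.height y (Pi.single a 1)) (Pi.single a 1)) := by
    rw [hder.fderiv]; rfl
  have hsig : dsigma (fun a => fderiv ℝ c.param y (Pi.single a 1))
      = graphNormal c.rot c.height y := by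
    rw [htan, dsigma_rot c.rot c.det_rot, dsigma_graph_tangent]; rfl
  change star (F (c.param y)) * (dsigma _ * _) = _
  rw [hsig]

/-- On the closure of a bounded domain, a function in `C¹(Ω̄)` and its continuously extended
`D̄F` are restrictions of continuous functions. -/
theorem IsC1Closure.exists_continuous_extension {F : ℍ → ℍ} (hF : IsC1Closure Ω F) :
    ∃ A B : ℍ → ℍ, Continuous A ∧ Continuous B ∧ EqOn A F (closure Ω) ∧
      EqOn B (fueterDbar F) Ω ∧ EqOn B (extendFrom Ω (fueterDbar F)) (closure Ω) := by
  obtain ⟨-, hFc, G, hG, hGF⟩ := hF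
  have hGB : ContinuousOn (fun q => dbarOp (G q)) (closure Ω) :=
    dbarOp.continuous.comp_continuousOn hG
  -- Tietze extension: globally continuous `A` and `B` avoid any case distinction where a chart
  -- leaves the closure of `Ω`.
  obtain ⟨A, hA⟩ := ContinuousMap.exists_restrict_eq isClosed_closure ⟨_, hFc.domRestrict⟩
  obtain ⟨B, hB⟩ := ContinuousMap.exists_restrict_eq isClosed_closure ⟨_, hGB.domRestrict⟩
  have hA' : EqOn A F (closure Ω) := fun q hq => congrArg (fun f => f ⟨q, hq⟩) hA
  have hB' : EqOn B (fun q => dbarOp (G q)) (closure Ω) := fun q hq =>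
    congrArg (fun f => f ⟨q, hq⟩) hB
  have hBD : EqOn B (fueterDbar F) Ω := fun q hq => by
    rw [hB' (subset_closure hq), fueterDbar_eq_dbarOp, ← hGF hq]
  refine ⟨A, B, A.continuous, B.continuous, hA', hBD, fun q hq => ?_⟩
  refine (extendFrom_eq hq ?_).symm
  refine ((B.continuous.tendsto q).mono_left nhdsWithin_le_nhds).congr' ?_
  filter_upwards [self_mem_nhdsWithin] with z hz
  exact hBD hz

/-- The flux identity is applied to the weights of an arbitrary atlas, so the value is visibly
independent of the atlas. The factor `2` comes from the `1 / 2` in the definition of `D̄`. -/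
theorem hasBoundaryIntegral_stokesForm (hΩ : IsLipschitzDomain Ω) {F : ℍ → ℍ}
    (hF : IsC1Closure Ω F) (hreg : IsLeftRegular Ω F) :
    IntegrableOn (fun q => ‖fueterDbar F q‖ ^ 2) Ω ∧
      HasBoundaryIntegral Ω (stokesForm Ω F)
        ((2 * ∫ q in Ω, ‖fueterDbar F q‖ ^ 2 : ℝ) : ℍ) := by
  obtain ⟨A, B, hAc, hBc, hAF, hBF, hBext⟩ := hF.exists_continuous_extension
  have hder : ∀ q ∈ Ω, fderiv ℝ A q = fderiv ℝ F q := fun q hq =>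
    ((hAF.mono subset_closure).eventuallyEq_of_mem (hΩ.isOpen.mem_nhds hq)).fderiv_eq
  have hA : IsLeftRegular Ω A := by
    refine ⟨hreg.1.congr (hAF.mono subset_closure), fun q hq => ?_⟩
    rw [fueterD_eq_dOp, hder q hq, ← fueterD_eq_dOp, hreg.2 q hq]
  have hAB : EqOn B (fueterDbar A) Ω := fun q hq => by
    rw [hBF hq, fueterDbar_eq_dbarOp, fueterDbar_eq_dbarOp, hder q hq]
  have hsq : EqOn (fun q => ‖B q‖ ^ 2) (fun q => ‖fueterDbar F q‖ ^ 2) Ω := fun q hq => by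
    simp only [hBF hq]
  refine ⟨(integrableOn_of_continuous hΩ.isBounded (by fun_prop)).congr_fun hsq
    hΩ.isOpen.measurableSet, ?_, fun n 𝒜 => ?_⟩
  · have hcpt : IsCompact (frontier Ω) :=
      hΩ.isBounded.isCompact_closure.of_isClosed_subset isClosed_frontier frontier_subset_closure
    obtain ⟨n, c, θ, h1, h2, h3, h4, h5⟩ := exists_partition_of_charts hcpt hΩ.exists_chart
    exact ⟨n, ⟨⟨c, θ, h1, h2, h3, h4, h5⟩⟩⟩
  have hw : ∀ i, ContDiff ℝ 1 (𝒜.weight i) := fun i =>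
    (𝒜.contDiff_weight i).of_le (by exact_mod_cast le_top)
  have hae : ∀ i, (fun y => 𝒜.weight i ((𝒜.chart i).param y) •
      (𝒜.chart i).pullback (stokesForm Ω F) y) =ᵐ[volume] fun y =>
        𝒜.weight i ((𝒜.chart i).param y) • (star (A ((𝒜.chart i).param y)) *
          graphNormal (𝒜.chart i).rot (𝒜.chart i).height y * B ((𝒜.chart i).param y)) := fun i => by
    filter_upwards [(𝒜.chart i).pullback_stokesForm_ae F] with y hy
    -- `A` and `B` are known to match `F` and the extended `D̄F` only on the closure; a parameter
    -- value leaving the chart neighbourhood may miss it, but there the weight is zero.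
    by_cases hmem : (𝒜.chart i).param y ∈ (𝒜.chart i).nbhd
    · have hcl := frontier_subset_closure ((𝒜.chart i).param_mem_frontier hmem)
      rw [hy, ← hAF hcl, ← hBext hcl, mul_assoc]
    · rw [image_eq_zero_of_notMem_tsupport fun h => hmem (𝒜.tsupport_weight i h), zero_smul,
        zero_smul]
  refine ⟨fun i => ?_, ?_⟩
  · refine Integrable.congr ?_ (hae i).symm
    obtain ⟨C, hh⟩ := (𝒜.chart i).lipschitz_height
    have hp : Continuous (𝒜.chart i).param := by
      have h := (continuous_graphMap (R := (𝒜.chart i).rot) hh.continuous).comp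
        (by fun_prop : Continuous fun y : Fin 3 → ℝ => ((0 : ℝ), y))
      exact h.congr fun y => ((𝒜.chart i).param_eq_graphMap y).symm
    refine integrable_flux hh ((hw i).continuous.comp hp) ?_ (hAc.comp hp) (hBc.comp hp)
    rw [show (𝒜.chart i).param = fun y => graphMap (𝒜.chart i).rot (𝒜.chart i).height (0, y) from
      funext (𝒜.chart i).param_eq_graphMap]
    exact hasCompactSupport_comp_graph ((𝒜.hasCompactSupport_weight i).comp_homeomorph
      (rotEquiv (𝒜.chart i).rot).toHomeomorph) _ 0
  · rw [← setIntegral_congr_fun hΩ.isOpen.measurableSet hsq,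
      ← sum_integral_fluxDiv hΩ hAc hBc hA hAB hw 𝒜.sum_weight]
    refine Finset.sum_congr rfl fun i _ => ?_
    rw [integral_congr_ae (hae i), (𝒜.chart i).integral_fluxDiv hΩ.isOpen hAc hBc hA hAB (hw i)
      (𝒜.hasCompactSupport_weight i) (𝒜.tsupport_weight i)]

/-- The existence of an atlas is part of the definition; without it every value would qualify
vacuously. -/
theorem HasBoundaryIntegral.unique {η : ℍ → ℍ [⋀^Fin 3]→ₗ[ℝ] ℍ} {I J : ℍ}
    (hI : HasBoundaryIntegral Ω η I) (hJ : HasBoundaryIntegral Ω η J) : I = J := by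
  obtain ⟨n, ⟨𝒜⟩⟩ := hI.1
  rw [← (hI.2 n 𝒜).2, ← (hJ.2 n 𝒜).2]

theorem HasBoundaryIntegral.boundaryIntegral_eq {η : ℍ → ℍ [⋀^Fin 3]→ₗ[ℝ] ℍ} {I : ℍ}
    (hI : HasBoundaryIntegral Ω η I) : boundaryIntegral Ω η = I := by
  have h : BoundaryIntegrable Ω η := ⟨I, hI⟩
  rw [boundaryIntegral, dif_pos h]
  exact h.choose_spec.unique hI

end Global

end QuatStokes

theorem mainTheorem2 (Ω : Set ℍ) (hΩ : QuatStokes.IsLipschitzDomain Ω) (F : ℍ → ℍ)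
    (hF : QuatStokes.IsC1Closure Ω F) (hreg : QuatStokes.IsLeftRegular Ω F) :
    IntegrableOn (fun q => ‖QuatStokes.fueterDbar F q‖ ^ 2) Ω ∧
      QuatStokes.BoundaryIntegrable Ω (QuatStokes.stokesForm Ω F) ∧
      ((∫ q in Ω, ‖QuatStokes.fueterDbar F q‖ ^ 2 : ℝ) : ℍ) =
        (1 / 2 : ℝ) • QuatStokes.boundaryIntegral Ω (QuatStokes.stokesForm Ω F) := by
  obtain ⟨h1, h2⟩ := QuatStokes.hasBoundaryIntegral_stokesForm hΩ hF hreg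
  refine ⟨h1, ⟨_, h2⟩, ?_⟩
  rw [h2.boundaryIntegral_eq, ← Quaternion.coe_smul, smul_eq_mul]
  congr 1
  ring
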